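/- Let $N\ge 1$ and let $q,t>0$ be real numbers with $q<\min(1,t^{-N})$ or $q>\max(1,t^{-N})$. **Compositions.** For $\alpha\in\mathbb N_0^N$ let $|\alpha|=\sum_i\alpha_i$, let $\alpha^+$ be the nonincreasing rearrangement of $\alpha$, $\mathrm{inv}(\alpha)=\#\{i<j:\alpha_i<\alpha_j\}$, $r_\alpha(i)=\#\{j:\alpha_j>\alpha_i\}+\#\{j\le i:\alpha_j=\alpha_i\}$, and $k(\alpha)=\sum_{i=1}^N(N-2i+1)\alpha_i$. Write $\alpha\succ\beta$ if $\alpha\ne\beta$ and $\sum_{i\le j}\alpha_i\ge\sum_{i\le j}\beta_i$ for $1\le j\le N$, and $\alpha\vartriangleright\beta$ if $|\alpha|=|\beta|$ and either $\alpha^+\succ\beta^+$, or $\alpha^+=\beta^+$ and $\alpha\succ\beta$. **Operators.** On $\mathbb R[x_1,\dots,x_N]$, acting on the right, let $$p\,T_i=(1-t)\,x_{i+1}\frac{p(x)-p(x.s_i)}{x_i-x_{i+1}}+t\,p(x.s_i)\quad(1\le i<N),$$ where $x.s_i$ is $x$ with $x_i,x_{i+1}$ interchanged; let $(f w)(x)=f(qx_N,x_1,\dots,x_{N-1})$,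 and $$f\,\xi_i=t^{i-1}\,f\,T_{i-1}^{-1}\cdots T_1^{-1}\,w\,T_{N-1}\cdots T_i\quad(1\le i\le N).$$ **Nonsymmetric Macdonald polynomials.** $M_\alpha$ is the polynomial with $M_\alpha\xi_i=q^{\alpha_i}t^{N-r_\alpha(i)}M_\alpha$ for $1\le i\le N$ and $$M_\alpha=q^{\sum_i\binom{\alpha_i}{2}}\,t^{\,k(\alpha^+)-\mathrm{inv}(\alpha)}\,x^\alpha+\sum_{\beta:\,\alpha\vartriangleright\beta}A_{\alpha\beta}\,x^\beta .$$ **The form.** Put $u(z)=\frac{(t-z)(1-zt)}{(1-z)^2}$ and $$\mathcal E(\alpha)=\prod_{i<j,\ \alpha_i<\alpha_j}u\big(q^{\alpha_j-\alpha_i}t^{r_\alpha(i)-r_\alpha(j)}\big).$$ For a partition $\lambda=\lambda^+$ with transpose $\lambda'$ put $h_{q,t}(\lambda;z)=\prod_{(i,j)\in\lambda}\big(1-zq^{\lambda_i-j}t^{\lambda'_j-i}\big)$ and $(z;q,t)_\lambda=\prod_{i=1}^N\prod_{s=1}^{\lambda_i}\big(1-zt^{1-i}q^{s-1}\big)$.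 Let $\langle\cdot,\cdot\rangle$ be the symmetric bilinear form on $\mathbb R[x_1,\dots,x_N]$ with $\langle M_\alpha,M_\beta\rangle=0$ for $\alpha\ne\beta$ and $$\langle M_\alpha,M_\alpha\rangle=\mathcal E(\alpha)^{-1}\,t^{k(\lambda)}\,\frac{h_{q,t}(\lambda;q)}{h_{q,t}(\lambda;qt)}\,\frac{(qt^{N};q,t)_\lambda}{(1-q)^{|\lambda|}},\qquad\lambda=\alpha^+ .$$ **Proposition.** The polynomials $M_\alpha$, $\alpha\in\mathbb N_0^N$, exist and form a basis of $\mathbb R[x_1,\dots,x_N]$, so that the form is defined, and it is positive-definite: $\langle M_\alpha,M_\alpha\rangle>0$ for all $\alpha\in\mathbb N_0^N$, and hence $\langle f,f\rangle>0$ for all $f\ne0$. -/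

import Mathlib

namespace ScalarMacdonald

open MvPolynomial

noncomputable section

/-- Compositions `α = (α₁, …, α_N)` of nonnegative integers; positions are numbered
`0, …, N - 1` here instead of `1, …, N`. -/
abbrev Comp (N : ℕ) := Fin N → ℕ

/-- The real polynomials in `x₁, …, x_N`. -/
abbrev Poly (N : ℕ) := MvPolynomial (Fin N) ℝ

/-! ### Combinatorics of compositions -/

/-- The nonincreasing rearrangement `α⁺`. -/
def plus {N : ℕ} (α : Comp N) : Comp N :=
  α ∘ Tuple.sort (fun i => OrderDual.toDual (α i))

/-- `α⁺` is nonincreasing (and it is a rearrangement of `α` by construction). -/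
theorem plus_antitone {N : ℕ} (α : Comp N) : Antitone (plus α) :=
  fun _ _ h => Tuple.monotone_sort (fun i => OrderDual.toDual (α i)) h

/-- Strict dominance: `α ≻ β`. -/
def Dominates {N : ℕ} (α β : Comp N) : Prop :=
  α ≠ β ∧ ∀ j : Fin N, ∑ i ∈ Finset.Iic j, β i ≤ ∑ i ∈ Finset.Iic j, α i

/-- The order `α ▷ β` on compositions. -/
def Above {N : ℕ} (α β : Comp N) : Prop :=
  ∑ i, α i = ∑ i, β i ∧
    (Dominates (plus α) (plus β) ∨ (plus α = plus β ∧ Dominates α β))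

/-- The number of pairs `i < j` with `α_i < α_j`. -/
def inv {N : ℕ} (α : Comp N) : ℕ :=
  (Finset.univ.filter (fun p : Fin N × Fin N => p.1 < p.2 ∧ α p.1 < α p.2)).card

/-- The rank function `r_α`, with values in `1, …, N`. -/
def rank {N : ℕ} (α : Comp N) (i : Fin N) : ℕ :=
  (Finset.univ.filter (fun j => α i < α j)).card +
    (Finset.univ.filter (fun j => j ≤ i ∧ α j = α i)).card

/-- `k(λ) = ∑ (N - 2i + 1) λ_i`, the sum over the positions `i = 1, …, N`. -/
def kExp {N : ℕ} (l : Comp N) : ℤ :=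
  ∑ i : Fin N, ((N : ℤ) - 2 * ((i : ℤ) + 1) + 1) * (l i : ℤ)

/-! ### Operators on polynomials -/

/-- The polynomial `p(x.s)`, where `s` interchanges the coordinates `a` and `b`. -/
def swapVars {N : ℕ} (a b : Fin N) (p : Poly N) : Poly N :=
  rename (Equiv.swap a b) p

theorem dvd_sub_swapVars {N : ℕ} (a b : Fin N) (p : Poly N) :
    (X a - X b : Poly N) ∣ p - swapVars a b p := by
  rw [← Ideal.mem_span_singleton, ← Ideal.Quotient.mk_eq_mk_iff_sub_mem]
  set I : Ideal (Poly N) := Ideal.span {X a - X b}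
  have hab : Ideal.Quotient.mkₐ ℝ I (X a) = Ideal.Quotient.mkₐ ℝ I (X b) := by
    rw [Ideal.Quotient.mkₐ_eq_mk, Ideal.Quotient.mk_eq_mk_iff_sub_mem]
    exact Ideal.mem_span_singleton_self _
  have key : (Ideal.Quotient.mkₐ ℝ I) =
      (Ideal.Quotient.mkₐ ℝ I).comp (rename (Equiv.swap a b)) := by
    apply MvPolynomial.algHom_ext
    intro c
    simp only [AlgHom.comp_apply, rename_X]
    by_cases h1 : c = a
    · rw [h1, Equiv.swap_apply_left, hab]
    · by_cases h2 : c = b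
      · rw [h2, Equiv.swap_apply_right, hab]
      · rw [Equiv.swap_apply_of_ne_of_ne h1 h2]
  exact DFunLike.congr_fun key p

/-- The polynomial `(p(x) - p(x.s)) / (x_a - x_b)`, where `s` interchanges the coordinates
`a` and `b` (it is used for `a ≠ b` only). -/
def divDiff {N : ℕ} (a b : Fin N) (p : Poly N) : Poly N :=
  (dvd_sub_swapVars a b p).choose

theorem mul_divDiff {N : ℕ} (a b : Fin N) (p : Poly N) :
    (X a - X b) * divDiff a b p = p - swapVars a b p :=
  (dvd_sub_swapVars a b p).choose_spec.symm

/-- The Hecke algebra generator `p ↦ p T` attached to the adjacent coordinates `k`, `k + 1`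
(numbered from `0`):
`p T = (1 - t) x_{k+1} (p(x) - p(x.s)) / (x_k - x_{k+1}) + t p(x.s)`.
It is only used for `k + 1 < N`. -/
def heckeT {N : ℕ} (t : ℝ) (k : ℕ) (p : Poly N) : Poly N :=
  if h : k + 1 < N then
    C (1 - t) * X (⟨k + 1, h⟩ : Fin N) *
        divDiff ⟨k, (Nat.lt_succ_self k).trans h⟩ ⟨k + 1, h⟩ p +
      C t * swapVars ⟨k, (Nat.lt_succ_self k).trans h⟩ ⟨k + 1, h⟩ p
  else p

/-- The inverse generator `T⁻¹ = (T + 1 - t) / t`. -/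
def heckeTInv {N : ℕ} (t : ℝ) (k : ℕ) (p : Poly N) : Poly N :=
  C t⁻¹ * (heckeT t k p + C (1 - t) * p)

/-- The shift `(f w)(x) = f(q x_N, x₁, …, x_{N-1})`. -/
def shift {N : ℕ} (q : ℝ) (f : Poly N) : Poly N :=
  aeval (fun i : Fin N =>
    if (i : ℕ) = 0 then (C q * X ⟨N - 1, by have := i.isLt; omega⟩ : Poly N)
    else X ⟨(i : ℕ) - 1, by have := i.isLt; omega⟩) f

/-- The Cherednik operator: for the 1-based index `i + 1`,
`f ξ_{i+1} = t^i f T_i⁻¹ T_{i-1}⁻¹ ⋯ T₁⁻¹ w T_{N-1} T_{N-2} ⋯ T_{i+1}`.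
Operators act on the right: `T_i⁻¹` is applied first, `T_{i+1}` last. The generator
`T_m` is `heckeT t (m - 1)`. -/
def cherednik {N : ℕ} (q t : ℝ) (i : Fin N) (f : Poly N) : Poly N :=
  C (t ^ (i : ℕ)) *
    (List.range' (i : ℕ) (N - 1 - (i : ℕ))).foldr (heckeT t)
      (shift q ((List.range (i : ℕ)).foldr (heckeTInv t) f))

/-! ### Nonsymmetric Macdonald polynomials -/

/-- The spectral vector `ζ_α(i) = q^{α_i} t^{N - r_α(i)}`. -/
def spectral {N : ℕ} (q t : ℝ) (α : Comp N) (i : Fin N) : ℝ :=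
  q ^ α i * t ^ ((N : ℤ) - (rank α i : ℤ))

/-- The coefficient of `x^α` in `M_α`. It is the monomial in `q`, `t` that is produced by
starting at `M_0 = 1` and applying the steps
`M_{(α₂, …, α_N, α₁ + 1)} = x_N (M_α w)` and, for `α_i < α_{i+1}`,
`M_{α.s_i} = M_α T_i + (1 - t) / (1 - ζ_α(i+1) / ζ_α(i)) M_α`. -/
def leadingCoeff {N : ℕ} (q t : ℝ) (α : Comp N) : ℝ :=
  q ^ (∑ i, (α i).choose 2) * t ^ (kExp (plus α) - (inv α : ℤ))

/-- `p` is the nonsymmetric Macdonald polynomial `M_α`: a simultaneous eigenfunction of the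
Cherednik operators, with the spectral vector of `α` and leading term `q^* t^* x^α`. -/
structure IsMacdonald {N : ℕ} (q t : ℝ) (α : Comp N) (p : Poly N) : Prop where
  coeff_self : coeff (Finsupp.equivFunOnFinite.symm α) p = leadingCoeff q t α
  triangular : ∀ β : Comp N, coeff (Finsupp.equivFunOnFinite.symm β) p ≠ 0 →
    β = α ∨ Above α β
  eigen : ∀ i : Fin N, cherednik q t i p = C (spectral q t α i) * p

open Classical in
/-- The nonsymmetric Macdonald polynomial `M_α` (zero if there is none). -/
def macdonald {N : ℕ} (q t : ℝ) (α : Comp N) : Poly N :=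
  if h : ∃ p, IsMacdonald q t α p then h.choose else 0

/-! ### The norm formula and the bilinear form -/

/-- `u(z) = (t - z)(1 - z t) / (1 - z)²`. -/
def u (t z : ℝ) : ℝ := (t - z) * (1 - z * t) / (1 - z) ^ 2

/-- `𝓔(α)`, the product of `u(q^{α_j - α_i} t^{r_α(i) - r_α(j)})` over the pairs `i < j` with
`α_i < α_j`. -/
def scriptE {N : ℕ} (q t : ℝ) (α : Comp N) : ℝ :=
  ∏ p ∈ Finset.univ.filter (fun p : Fin N × Fin N => p.1 < p.2 ∧ α p.1 < α p.2),
    u t (q ^ ((α p.2 : ℤ) - (α p.1 : ℤ)) * t ^ ((rank α p.1 : ℤ) - (rank α p.2 : ℤ)))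

/-- The part `λ'_j` of the transpose of the partition `λ`, for `j ≥ 1`. -/
def conj {N : ℕ} (l : Comp N) (j : ℕ) : ℕ :=
  (Finset.univ.filter (fun i => j ≤ l i)).card

/-- The hook product `h_{q,t}(λ; z) = ∏ (1 - z q^arm t^leg)` over the boxes `(i, j)` of the
partition `λ`, with `arm = λ_i - j` and `leg = λ'_j - i` (`i`, `j` numbered from `1`). -/
def hookProd {N : ℕ} (q t : ℝ) (l : Comp N) (z : ℝ) : ℝ :=
  ∏ i : Fin N, ∏ j ∈ Finset.Icc 1 (l i),
    (1 - z * q ^ ((l i : ℤ) - (j : ℤ)) * t ^ ((conj l j : ℤ) - ((i : ℤ) + 1)))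

/-- `(z; q)_n = ∏_{i = 1}^{n} (1 - z q^{i-1})`. -/
def qPoch (q z : ℝ) (n : ℕ) : ℝ := ∏ i ∈ Finset.range n, (1 - z * q ^ i)

/-- `(z; q, t)_λ = ∏_{i = 1}^{N} (z t^{1-i}; q)_{λ_i}`. -/
def qtPoch {N : ℕ} (q t z : ℝ) (l : Comp N) : ℝ :=
  ∏ i : Fin N, qPoch q (z * t ^ (-(i : ℤ))) (l i)

/-- The value of `⟨M_λ, M_λ⟩` for a partition `λ`. -/
def partitionNorm {N : ℕ} (q t : ℝ) (l : Comp N) : ℝ :=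
  t ^ kExp l * (hookProd q t l q / hookProd q t l (q * t)) *
    (qtPoch q t (q * t ^ N) l / (1 - q) ^ (∑ i, l i))

/-- The value of `⟨M_α, M_α⟩` for a composition `α`. -/
def compNorm {N : ℕ} (q t : ℝ) (α : Comp N) : ℝ :=
  (scriptE q t α)⁻¹ * partitionNorm q t (plus α)

open Classical in
/-- The symmetric bilinear form for which the `M_α` are mutually orthogonal and `⟨M_α, M_α⟩` has
the value `compNorm q t α`; it is defined when the `M_α` are a basis of the polynomials, and zero
otherwise. -/
def scalarForm (N : ℕ) (q t : ℝ) : LinearMap.BilinForm ℝ (Poly N) :=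
  if h : LinearIndependent ℝ (macdonald (N := N) q t) ∧
      ⊤ ≤ Submodule.span ℝ (Set.range (macdonald (N := N) q t)) then
    (Module.Basis.mk h.1 h.2).constr ℝ
      (fun α => compNorm q t α • (Module.Basis.mk h.1 h.2).coord α)
  else 0

end

end ScalarMacdonald

namespace ScalarMacdonald

open MvPolynomial

noncomputable section

/-! ### The Hecke relations -/

/-! The condition on `q` and `t` says that `1 - q` and `1 - q t^N` are nonzero of the same sign.
Since `t^m` lies between `1` and `t^N`, every `1 - q^a t^m` with `a ≥ 1` and `0 ≤ m ≤ N` then has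
the sign of `1 - q` (`one_sub_mul_one_sub_pos`). The norm is built from such factors: the two hook
products have equally many of them, the Pochhammer product is divided by as many factors `1 - q`,
and each `u(z)` is a positive multiple of a product of two of them over a square. Hence every norm
is positive (`compNorm_pos`).

The main work is to show that the `M_α` exist and form a basis. The affine Hecke relations make the
Cherednik operators commute (`commute_cherednikEnd`). They are triangular on monomials for the order
`▷`, with the spectral vectors on the diagonal (`isTri_cherednikEnd`), and these vectors are
pairwise distinct (`spectral_injective`). So a product of operators `ξ_i - ζ_β(i)`, over the
finitely many `β` below `α`, kills all `x^β` below `α` but keeps a nonzero multiple of `x^α`;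
applied to `x^α` it yields a joint eigenvector (`exists_annihilator`, `exists_isMacdonald`).

Any family with these leading terms is a basis by triangularity, so uniqueness of `M_α` plays no
role. In this basis the form is diagonal with positive entries (`scalarForm_pos`). -/

theorem X_sub_X_ne_zero {N : ℕ} {a b : Fin N} (h : a ≠ b) : (X a - X b : Poly N) ≠ 0 :=
  sub_ne_zero.mpr fun e => h (X_injective e)

theorem swapVars_swapVars {N : ℕ} (a b : Fin N) (p : Poly N) :
    swapVars a b (swapVars a b p) = p := by
  simp only [swapVars, rename_rename]
  convert rename_id_apply p
  ext x
  simp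

/-- `divDiff` is determined by the identity defining it. -/
theorem divDiff_eq {N : ℕ} {a b : Fin N} (h : a ≠ b) {p r : Poly N}
    (e : (X a - X b) * r = p - swapVars a b p) : divDiff a b p = r :=
  mul_left_cancel₀ (X_sub_X_ne_zero h) ((mul_divDiff a b p).trans e.symm)

/-- The divided difference as a linear map, multiplied by `x_b`. -/
def xDivDiff {N : ℕ} (a b : Fin N) (h : a ≠ b) : Module.End ℝ (Poly N) where
  toFun p := X b * divDiff a b p
  map_add' p r := by
    rw [← mul_add]
    congr 1
    apply divDiff_eq h
    rw [mul_add, mul_divDiff, mul_divDiff]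
    simp only [swapVars, map_add]
    ring
  map_smul' c p := by
    rw [RingHom.id_apply, ← mul_smul_comm]
    congr 1
    apply divDiff_eq h
    rw [mul_smul_comm, mul_divDiff]
    simp only [swapVars, map_smul, smul_sub]

theorem xDivDiff_apply {N : ℕ} {a b : Fin N} (h : a ≠ b) (p : Poly N) :
    xDivDiff a b h p = X b * divDiff a b p := rfl

theorem mul_xDivDiff {N : ℕ} {a b : Fin N} (h : a ≠ b) (p : Poly N) :
    (X a - X b) * xDivDiff a b h p = X b * (p - rename (Equiv.swap a b) p) := by
  have := mul_divDiff a b p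
  rw [xDivDiff_apply]
  simp only [swapVars] at this
  linear_combination X b * this

/-- A permutation of the variables, as a linear map. -/
def permVars {N : ℕ} (σ : Equiv.Perm (Fin N)) : Module.End ℝ (Poly N) :=
  (rename σ : Poly N →ₐ[ℝ] Poly N).toLinearMap

theorem permVars_apply {N : ℕ} (σ : Equiv.Perm (Fin N)) (p : Poly N) :
    permVars σ p = rename σ p := rfl

theorem permVars_mul {N : ℕ} (σ τ : Equiv.Perm (Fin N)) :
    permVars (σ * τ) = permVars σ * permVars τ := by
  ext1
  ext1
  simp [permVars, rename_rename]

theorem permVars_one {N : ℕ} : permVars (1 : Equiv.Perm (Fin N)) = 1 := by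
  apply LinearMap.ext
  intro p
  exact rename_id_apply p

theorem permVars_mul_xDivDiff {N : ℕ} (σ : Equiv.Perm (Fin N)) {a b : Fin N} (h : a ≠ b) :
    permVars σ * xDivDiff a b h =
      xDivDiff (σ a) (σ b) (σ.injective.ne h) * permVars σ := by
  apply LinearMap.ext
  intro p
  apply mul_left_cancel₀ (X_sub_X_ne_zero (σ.injective.ne h))
  have e := congrArg (rename σ : Poly N →ₐ[ℝ] Poly N) (mul_xDivDiff h p)
  simp only [map_mul, map_sub, rename_X] at e
  simp only [Module.End.mul_apply, permVars_apply]
  rw [e, mul_xDivDiff]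
  congr 2
  rw [rename_rename, rename_rename]
  congr 1
  ext x
  simp [Equiv.swap_apply_def]
  split_ifs <;> simp

/-- The generator `T` attached to the coordinates `a` and `b`. -/
def heckePair {N : ℕ} (t : ℝ) (a b : Fin N) (h : a ≠ b) : Module.End ℝ (Poly N) :=
  (1 - t) • xDivDiff a b h + t • permVars (Equiv.swap a b)

/-- The generator with its denominator cleared. The quadratic, commutation and braid relations
follow from this identity and its images under permutations of the variables, by cancellation in the
domain of polynomials. -/
theorem mul_heckePair {N : ℕ} (t : ℝ) {a b : Fin N} (h : a ≠ b) (p : Poly N) :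
    (X a - X b) * heckePair t a b h p =
      (1 - C t) * X b * p + (C t * X a - X b) * rename (Equiv.swap a b) p := by
  have e := mul_xDivDiff h p
  simp only [heckePair, LinearMap.add_apply, LinearMap.smul_apply, permVars_apply,
    smul_eq_C_mul, map_sub, map_one]
  linear_combination (1 - C t) * e

theorem heckePair_quadratic {N : ℕ} (t : ℝ) {a b : Fin N} (h : a ≠ b) :
    heckePair t a b h * heckePair t a b h = t • 1 - (1 - t) • heckePair t a b h := by
  apply LinearMap.ext
  intro p
  apply mul_left_cancel₀ (mul_ne_zero (X_sub_X_ne_zero h) (X_sub_X_ne_zero h))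
  have e := mul_heckePair t h p
  have e1 := mul_heckePair t h (heckePair t a b h p)
  have e2 := congrArg (rename (Equiv.swap a b) : Poly N →ₐ[ℝ] Poly N) e
  simp only [map_mul, map_sub, map_add, rename_X, map_one, rename_C, rename_rename,
    Equiv.swap_apply_left, Equiv.swap_apply_right] at e2
  rw [show (Equiv.swap a b ∘ Equiv.swap a b : Fin N → Fin N) = id by ext x; simp,
    rename_id_apply] at e2
  simp only [Module.End.mul_apply, LinearMap.sub_apply, LinearMap.smul_apply,
    Module.End.one_apply, smul_eq_C_mul, map_sub, map_one]
  linear_combination (X a - X b) * e1 + (1 - C t) * X b * e - (C t * X a - X b) * e2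
    + (1 - C t) * (X a - X b) * e

theorem heckePair_comm {N : ℕ} (t : ℝ) {a b c d : Fin N} (h : a ≠ b) (h' : c ≠ d)
    (hac : a ≠ c) (had : a ≠ d) (hbc : b ≠ c) (hbd : b ≠ d) :
    heckePair t a b h * heckePair t c d h' = heckePair t c d h' * heckePair t a b h := by
  apply LinearMap.ext
  intro p
  apply mul_left_cancel₀ (mul_ne_zero (X_sub_X_ne_zero h) (X_sub_X_ne_zero h'))
  have e := mul_heckePair t h p
  have e' := mul_heckePair t h' p
  have f := mul_heckePair t h (heckePair t c d h' p)
  have f' := mul_heckePair t h' (heckePair t a b h p)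
  have g := congrArg (rename (Equiv.swap c d) : Poly N →ₐ[ℝ] Poly N) e
  have g' := congrArg (rename (Equiv.swap a b) : Poly N →ₐ[ℝ] Poly N) e'
  simp only [map_mul, map_sub, map_add, rename_X, map_one, rename_C,
    Equiv.swap_apply_of_ne_of_ne hac had, Equiv.swap_apply_of_ne_of_ne hbc hbd,
    Equiv.swap_apply_of_ne_of_ne hac.symm hbc.symm,
    Equiv.swap_apply_of_ne_of_ne had.symm hbd.symm] at g g'
  have k : rename (Equiv.swap a b) (rename (Equiv.swap c d) p) =
      rename (Equiv.swap c d) (rename (Equiv.swap a b) p) := by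
    have : Equiv.swap a b * Equiv.swap c d = Equiv.swap c d * Equiv.swap a b := by
      rw [Equiv.mul_swap_eq_swap_mul, Equiv.swap_apply_of_ne_of_ne hac.symm hbc.symm,
        Equiv.swap_apply_of_ne_of_ne had.symm hbd.symm]
    simpa only [permVars_mul, Module.End.mul_apply, permVars_apply] using
      DFunLike.congr_fun (congrArg permVars this) p
  simp only [Module.End.mul_apply]
  linear_combination (X c - X d) * f - (X a - X b) * f' + (1 - C t) * X b * e'
    - (1 - C t) * X d * e + (C t * X a - X b) * g' - (C t * X c - X d) * g
    + (C t * X a - X b) * (C t * X c - X d) * k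

theorem heckePair_braid {N : ℕ} (t : ℝ) {a b c : Fin N} (hab : a ≠ b) (hbc : b ≠ c)
    (hac : a ≠ c) :
    heckePair t a b hab * heckePair t b c hbc * heckePair t a b hab =
      heckePair t b c hbc * heckePair t a b hab * heckePair t b c hbc := by
  apply LinearMap.ext
  intro p
  have s1a : Equiv.swap a b c = c := Equiv.swap_apply_of_ne_of_ne hac.symm hbc.symm
  have s2a : Equiv.swap b c a = a := Equiv.swap_apply_of_ne_of_ne hab hac
  set s1 := (rename (Equiv.swap a b) : Poly N →ₐ[ℝ] Poly N) with hs1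
  set s2 := (rename (Equiv.swap b c) : Poly N →ₐ[ℝ] Poly N) with hs2
  have q1 : ∀ p, s1 (s1 p) = p := fun p => swapVars_swapVars a b p
  have q2 : ∀ p, s2 (s2 p) = p := fun p => swapVars_swapVars b c p
  have br : ∀ p, s1 (s2 (s1 p)) = s2 (s1 (s2 p)) := by
    intro p
    have : Equiv.swap a b * Equiv.swap b c * Equiv.swap a b =
        Equiv.swap b c * Equiv.swap a b * Equiv.swap b c := by
      rw [Equiv.mul_swap_eq_swap_mul (Equiv.swap a b * Equiv.swap b c), mul_assoc,
        Equiv.Perm.mul_apply, Equiv.Perm.mul_apply, Equiv.swap_apply_left, s2a,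
        Equiv.swap_apply_left, s1a]
    simp only [hs1, hs2]
    simpa only [permVars_mul, Module.End.mul_apply, permVars_apply] using
      DFunLike.congr_fun (congrArg permVars this) p
  have X1a : s1 (X a) = X b := by simp [hs1]
  have X1b : s1 (X b) = X a := by simp [hs1]
  have X1c : s1 (X c) = X c := by simp [hs1, s1a]
  have X2a : s2 (X a) = X a := by simp [hs2, s2a]
  have X2b : s2 (X b) = X c := by simp [hs2]
  have X2c : s2 (X c) = X b := by simp [hs2]
  have C1 : s1 (C t) = C t := by simp [hs1]
  have C2 : s2 (C t) = C t := by simp [hs2]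
  have T1 : ∀ p, (X a - X b) * heckePair t a b hab p =
      (1 - C t) * X b * p + (C t * X a - X b) * s1 p := mul_heckePair t hab
  have T2 : ∀ p, (X b - X c) * heckePair t b c hbc p =
      (1 - C t) * X c * p + (C t * X b - X c) * s2 p := mul_heckePair t hbc
  -- From here only `T1` and `T2` matter. Both triple products are expanded over the six permuted
  -- copies of `p`, and the coefficients are compared after clearing a common denominator.
  generalize heckePair t a b hab = U at *
  generalize heckePair t b c hbc = V at *
  have T11 : ∀ p, (X b - X a) * s1 (U p) =
      (1 - C t) * X a * s1 p + (C t * X b - X a) * p := by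
    intro p
    simpa [X1a, X1b, X1c, C1, q1] using congrArg s1 (T1 p)
  have T22 : ∀ p, (X c - X b) * s2 (V p) =
      (1 - C t) * X b * s2 p + (C t * X c - X b) * p := by
    intro p
    simpa [X2a, X2b, X2c, C2, q2] using congrArg s2 (T2 p)
  have T12 : ∀ p, (X a - X c) * s1 (V p) =
      (1 - C t) * X c * s1 p + (C t * X a - X c) * s1 (s2 p) := by
    intro p
    simpa [X1a, X1b, X1c, C1, q1] using congrArg s1 (T2 p)
  have T21 : ∀ p, (X a - X c) * s2 (U p) =
      (1 - C t) * X c * s2 p + (C t * X a - X c) * s2 (s1 p) := by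
    intro p
    simpa [X2a, X2b, X2c, C2, q2] using congrArg s2 (T1 p)
  have T121 : ∀ p, (X b - X c) * s1 (s2 (U p)) =
      (1 - C t) * X c * s1 (s2 p) + (C t * X b - X c) * s2 (s1 (s2 p)) := by
    intro p
    simpa [X1a, X1b, X1c, C1, q1, br] using congrArg s1 (T21 p)
  have T212 : ∀ p, (X a - X b) * s2 (s1 (V p)) =
      (1 - C t) * X b * s2 (s1 p) + (C t * X a - X b) * s2 (s1 (s2 p)) := by
    intro p
    simpa [X2a, X2b, X2c, C2, q2, br] using congrArg s2 (T12 p)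
  have nab := X_sub_X_ne_zero hab
  have nbc := X_sub_X_ne_zero hbc
  have nac := X_sub_X_ne_zero hac
  have L : (X a - X b) ^ 2 * (X b - X c) * (X a - X c) * U (V (U p)) =
      (1 - C t) * X b * (X a - X c) * ((1 - C t) * X c * ((1 - C t) * X b * p +
        (C t * X a - X b) * s1 p)) +
      (1 - C t) * X b * (X a - X b) * ((C t * X b - X c) * ((1 - C t) * X c * s2 p +
        (C t * X a - X c) * s2 (s1 p))) +
      (C t * X a - X b) * (X b - X c) * (- ((1 - C t) * X c * ((1 - C t) * X a * s1 p +
        (C t * X b - X a) * p))) +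
      (C t * X a - X b) * (C t * X a - X c) * (X a - X b) * ((1 - C t) * X c * s1 (s2 p) +
        (C t * X b - X c) * s2 (s1 (s2 p))) := by
    linear_combination (X a - X b) * (X b - X c) * (X a - X c) * T1 (V (U p)) +
      (1 - C t) * X b * (X a - X b) * (X a - X c) * T2 (U p) +
      (1 - C t) * X b * (X a - X c) * (1 - C t) * X c * T1 p +
      (1 - C t) * X b * (X a - X b) * (C t * X b - X c) * T21 p +
      (C t * X a - X b) * (X b - X c) * (X a - X b) * T12 (U p) -
      (C t * X a - X b) * (X b - X c) * (1 - C t) * X c * T11 p +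
      (C t * X a - X b) * (C t * X a - X c) * (X a - X b) * T121 p
  have R : (X b - X c) ^ 2 * (X a - X b) * (X a - X c) * V (U (V p)) =
      (1 - C t) * X c * (X a - X c) * ((1 - C t) * X b * ((1 - C t) * X c * p +
        (C t * X b - X c) * s2 p)) +
      (1 - C t) * X c * (X b - X c) * ((C t * X a - X b) * ((1 - C t) * X c * s1 p +
        (C t * X a - X c) * s1 (s2 p))) +
      (C t * X b - X c) * (X a - X b) * (- ((1 - C t) * X c * ((1 - C t) * X b * s2 p +
        (C t * X c - X b) * p))) +
      (C t * X b - X c) * (C t * X a - X c) * (X b - X c) * ((1 - C t) * X b * s2 (s1 p) +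
        (C t * X a - X b) * s2 (s1 (s2 p))) := by
    linear_combination (X a - X b) * (X b - X c) * (X a - X c) * T2 (U (V p)) +
      (1 - C t) * X c * (X b - X c) * (X a - X c) * T1 (V p) +
      (1 - C t) * X c * (X a - X c) * (1 - C t) * X b * T2 p +
      (1 - C t) * X c * (X b - X c) * (C t * X a - X b) * T12 p +
      (C t * X b - X c) * (X b - X c) * (X a - X b) * T21 (V p) -
      (C t * X b - X c) * (X a - X b) * (1 - C t) * X c * T22 p +
      (C t * X b - X c) * (C t * X a - X c) * (X b - X c) * T212 p
  have n : (X a - X b : Poly N) ^ 2 * (X b - X c) ^ 2 * (X a - X c) ≠ 0 :=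
    mul_ne_zero (mul_ne_zero (pow_ne_zero 2 nab) (pow_ne_zero 2 nbc)) nac
  apply mul_left_cancel₀ n
  simp only [Module.End.mul_apply]
  linear_combination (X b - X c) * L - (X a - X b) * R

/-! ### Commuting elements from the affine Hecke relations -/

/-- The product `T_i T_{i+1} ⋯ T_{i+m-1}`. -/
def ascProd {G : Type*} [Group G] (T : ℕ → G) (i m : ℕ) : G :=
  ((List.range' i m).map T).prod

/-- The product `T_0⁻¹ T_1⁻¹ ⋯ T_{m-1}⁻¹`. -/
def invProd {G : Type*} [Group G] (T : ℕ → G) (m : ℕ) : G :=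
  ((List.range m).map fun k => (T k)⁻¹).prod

section Group

variable {G : Type*} [Group G] {T : ℕ → G} {n : ℕ}

theorem ascProd_zero (i : ℕ) : ascProd T i 0 = 1 := by simp [ascProd]

theorem ascProd_succ (i m : ℕ) : ascProd T i (m + 1) = T i * ascProd T (i + 1) m := by
  simp [ascProd, List.range'_succ]

theorem ascProd_succ' (i m : ℕ) : ascProd T i (m + 1) = ascProd T i m * T (i + m) := by
  simp [ascProd, List.range'_concat]

theorem invProd_zero : invProd T 0 = 1 := by simp [invProd]

theorem invProd_succ (m : ℕ) : invProd T (m + 1) = invProd T m * (T m)⁻¹ := by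
  simp [invProd, List.range_succ]

theorem commute_ascProd (hc : ∀ k l, k + 1 < l → l + 1 < n → Commute (T k) (T l)) {k i m : ℕ}
    (hk : k + 1 < n) (hm : i + m < n) (h : k + 1 < i ∨ i + m < k) :
    Commute (T k) (ascProd T i m) := by
  induction m with
  | zero => rw [ascProd_zero]; exact Commute.one_right _
  | succ m ih =>
    rw [ascProd_succ']
    refine (ih (by omega) (by omega)).mul_right ?_
    rcases h with h | h
    · exact hc _ _ (by omega) (by omega)
    · exact (hc _ _ (by omega) (by omega)).symm

theorem commute_invProd (hc : ∀ k l, k + 1 < l → l + 1 < n → Commute (T k) (T l)) {k m : ℕ}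
    (hk : k + 1 < n) (h : m < k) : Commute (T k) (invProd T m) := by
  induction m with
  | zero => rw [invProd_zero]; exact Commute.one_right _
  | succ m ih =>
    rw [invProd_succ]
    exact (ih (by omega)).mul_right (hc _ _ (by omega) (by omega)).symm.inv_right

/-- One braid relation moves `T (k + 1)` past `T k * T (k + 1)` and turns it into `T k`; the
remaining factors are distant and commute with it. -/
theorem mul_ascProd (hc : ∀ k l, k + 1 < l → l + 1 < n → Commute (T k) (T l))
    (hb : ∀ k, k + 2 < n → T k * T (k + 1) * T k = T (k + 1) * T k * T (k + 1)) {k i m : ℕ}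
    (hi : i ≤ k) (hk : k + 1 < i + m) (hm : i + m < n) :
    T (k + 1) * ascProd T i m = ascProd T i m * T k := by
  induction m generalizing i with
  | zero => omega
  | succ m ih =>
    rcases hi.eq_or_lt with rfl | hi
    · obtain ⟨m, rfl⟩ : ∃ m', m = m' + 1 := ⟨m - 1, by omega⟩
      have e := (commute_ascProd hc (k := i) (i := i + 1 + 1) (m := m)
        (by omega) (by omega) (by omega)).eq
      rw [ascProd_succ, ascProd_succ, ← mul_assoc, ← mul_assoc, ← hb i (by omega),
        mul_assoc, e]
      simp only [mul_assoc]
    · have e := (hc i (k + 1) (by omega) (by omega)).eq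
      rw [ascProd_succ, ← mul_assoc, ← e, mul_assoc,
        ih (by omega) (by omega) (by omega), mul_assoc]

theorem mul_invProd (hc : ∀ k l, k + 1 < l → l + 1 < n → Commute (T k) (T l))
    (hb : ∀ k, k + 2 < n → T k * T (k + 1) * T k = T (k + 1) * T k * T (k + 1)) {k m : ℕ}
    (hk : k + 1 < m) (hm : m < n) :
    T (k + 1) * invProd T m = invProd T m * T k := by
  induction m with
  | zero => omega
  | succ m ih =>
    rcases (Nat.lt_succ_iff.mp hk).eq_or_lt with rfl | hk
    · have e := (commute_invProd hc (k := k + 1) (m := k) (by omega) (by omega)).eq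
      rw [invProd_succ, invProd_succ, ← mul_assoc, ← mul_assoc, e]
      simp only [mul_assoc]
      congr 1
      rw [eq_inv_mul_iff_mul_eq, eq_inv_mul_iff_mul_eq, ← mul_assoc, ← mul_assoc, ← mul_assoc,
        mul_inv_eq_iff_eq_mul, mul_inv_eq_iff_eq_mul]
      exact (hb k (by omega)).symm
    · have e := (hc k m (by omega) (by omega)).inv_right.eq
      rw [invProd_succ, ← mul_assoc, ih hk (by omega), mul_assoc, e, mul_assoc]

theorem ascProd_mul_ascProd (hc : ∀ k l, k + 1 < l → l + 1 < n → Commute (T k) (T l))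
    (hb : ∀ k, k + 2 < n → T k * T (k + 1) * T k = T (k + 1) * T k * T (k + 1)) {m l : ℕ}
    (hl : l < m) (hm : m < n) :
    ascProd T 0 m * ascProd T 0 l = ascProd T 1 l * ascProd T 0 m := by
  induction l with
  | zero => simp [ascProd_zero]
  | succ l ih =>
    rw [ascProd_succ', ← mul_assoc, ih (by omega), mul_assoc, zero_add,
      ← mul_ascProd hc hb (by omega) (by omega) (by omega), ascProd_succ' 1,
      mul_assoc, add_comm 1 l]

end Group

theorem mul_ascProd_comm {E : Type*} [Ring E] {T : ℕ → Eˣ} {n : ℕ} {w : E}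
    (hw : ∀ k, k + 2 < n → w * T (k + 1) = T k * w)
    {i m : ℕ}
    (h : i + m + 1 < n) :
    w * (ascProd T (i + 1) m : Eˣ) = (ascProd T i m : Eˣ) * w := by
  induction m with
  | zero => simp [ascProd_zero]
  | succ m ih =>
    rw [ascProd_succ', ascProd_succ', Units.val_mul, Units.val_mul, ← mul_assoc,
      ih (by omega), mul_assoc, show i + 1 + m = i + m + 1 by omega, hw _ (by omega), mul_assoc]

section Algebra

variable {E : Type*} [Ring E] [Algebra ℝ E] {T : ℕ → Eˣ} {n : ℕ} {w : E} {t : ℝ}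

/-- The Cherednik elements `t^i T_i ⋯ T_{n-2} w T_0⁻¹ ⋯ T_{i-1}⁻¹` of an algebra. -/
def cherednikElt (T : ℕ → Eˣ) (w : E) (t : ℝ) (n i : ℕ) : E :=
  t ^ i • ((ascProd T i (n - 1 - i) : Eˣ) * w * (invProd T i : Eˣ))

/-- This recursion reduces commutation of all the elements to that of the first two, together with
commutation with distant generators. -/
theorem cherednikElt_succ {i : ℕ} (hi : i + 1 < n) :
    cherednikElt T w t n (i + 1) =
      t • (((T i)⁻¹ : Eˣ) * cherednikElt T w t n i * ((T i)⁻¹ : Eˣ)) := by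
  obtain ⟨m, rfl⟩ : ∃ m, n = i + m + 2 := ⟨n - i - 2, by omega⟩
  rw [cherednikElt, cherednikElt, show i + m + 2 - 1 - (i + 1) = m by omega,
    show i + m + 2 - 1 - i = m + 1 by omega, ascProd_succ, invProd_succ, pow_succ']
  simp only [mul_smul_comm, smul_mul_assoc, smul_smul, Units.val_mul, mul_assoc,
    Units.inv_mul_cancel_left]

/-- Passing `w` from left to right raises the index of a generator by one. The inverse product
lowers it back if `k < i`; the ascending product has lowered it beforehand if `i < k`. -/
theorem commute_cherednikElt_gen
    (hc : ∀ k l, k + 1 < l → l + 1 < n → Commute (T k) (T l))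
    (hb : ∀ k, k + 2 < n → T k * T (k + 1) * T k = T (k + 1) * T k * T (k + 1))
    (hw : ∀ k, k + 2 < n → w * T (k + 1) = T k * w) {i k : ℕ} (hi : i < n) (hk : k + 1 < n)
    (hki : k ≠ i) (hki' : k + 1 ≠ i) : Commute (T k : E) (cherednikElt T w t n i) := by
  refine Commute.smul_right ?_ _
  rw [Commute, SemiconjBy]
  rcases lt_or_ge k i with h | h
  · have e1 := (commute_ascProd hc (k := k) (i := i) (m := n - 1 - i)
      (by omega) (by omega) (by omega)).eq
    have e2 := mul_invProd hc hb (k := k) (m := i) (by omega) (by omega)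
    have e3 := hw k (by omega)
    calc (T k : E) * ((ascProd T i (n - 1 - i) : Eˣ) * w * (invProd T i : Eˣ))
        = ((T k * ascProd T i (n - 1 - i) : Eˣ) : E) * w * (invProd T i : Eˣ) := by
          simp only [Units.val_mul, mul_assoc]
      _ = (ascProd T i (n - 1 - i) : Eˣ) * (T k * w) * (invProd T i : Eˣ) := by
          rw [e1]; simp only [Units.val_mul, mul_assoc]
      _ = (ascProd T i (n - 1 - i) : Eˣ) * w * ((T (k + 1) * invProd T i : Eˣ) : E) := by
          rw [← e3]; simp only [Units.val_mul, mul_assoc]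
      _ = _ := by rw [e2]; simp only [Units.val_mul, mul_assoc]
  · obtain ⟨k, rfl⟩ : ∃ k', k = k' + 1 := ⟨k - 1, by omega⟩
    have e1 := mul_ascProd hc hb (k := k) (i := i) (m := n - 1 - i)
      (by omega) (by omega) (by omega)
    have e2 := (commute_invProd hc (k := k + 1) (m := i) (by omega) (by omega)).eq
    have e3 := hw k (by omega)
    calc (T (k + 1) : E) * ((ascProd T i (n - 1 - i) : Eˣ) * w * (invProd T i : Eˣ))
        = ((T (k + 1) * ascProd T i (n - 1 - i) : Eˣ) : E) * w * (invProd T i : Eˣ) := by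
          simp only [Units.val_mul, mul_assoc]
      _ = (ascProd T i (n - 1 - i) : Eˣ) * (T k * w) * (invProd T i : Eˣ) := by
          rw [e1]; simp only [Units.val_mul, mul_assoc]
      _ = (ascProd T i (n - 1 - i) : Eˣ) * w * ((T (k + 1) * invProd T i : Eˣ) : E) := by
          rw [← e3]; simp only [Units.val_mul, mul_assoc]
      _ = _ := by rw [e2]; simp only [Units.val_mul, mul_assoc]

/-- With `Z = T_1 ⋯ T_{n-2} w`, the two elements are `T_0 Z` and `t Z T_0⁻¹`, so they commute once
`T_0` commutes with `Z²`. Pulling both copies of `w` to the right turns `Z²` into a product of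
generators times `w²`; `T_0` crosses the product as `T_{n-2}`, and `w²` turns it back into `T_0`. -/
theorem commute_cherednikElt_zero_one
    (hc : ∀ k l, k + 1 < l → l + 1 < n → Commute (T k) (T l))
    (hb : ∀ k, k + 2 < n → T k * T (k + 1) * T k = T (k + 1) * T k * T (k + 1))
    (hw : ∀ k, k + 2 < n → w * T (k + 1) = T k * w)
    (hw2 : w * w * T 0 = T (n - 2) * (w * w)) (hn : 1 < n) :
    Commute (cherednikElt T w t n 0) (cherednikElt T w t n 1) := by
  obtain ⟨m, rfl⟩ : ∃ m, n = m + 2 := ⟨n - 2, by omega⟩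
  rw [cherednikElt_succ hn]
  refine Commute.smul_right ?_ _
  have e0 : cherednikElt T w t (m + 2) 0 = T 0 * ((ascProd T 1 m : Eˣ) * w) := by
    rw [cherednikElt, show m + 2 - 1 - 0 = m + 1 by omega, ascProd_succ, invProd_zero]
    simp [mul_assoc]
  have e1 : (ascProd T 1 m : Eˣ) * w * ((ascProd T 1 m : Eˣ) * w) =
      ((ascProd T 1 m * ascProd T 0 m : Eˣ) : E) * (w * w) := by
    have := mul_ascProd_comm hw (i := 0) (m := m) (by omega)
    rw [Units.val_mul, mul_assoc, ← mul_assoc w, zero_add] at *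
    rw [this]
    simp only [mul_assoc]
  have e2 : T 0 * (ascProd T 1 m * ascProd T 0 m) =
      ascProd T 1 m * ascProd T 0 m * T m := by
    have := ascProd_mul_ascProd hc hb (m := m + 1) (l := m) (by omega) (by omega)
    rw [← mul_assoc, ← zero_add 1, ← ascProd_succ, this, ascProd_succ' 0 m, mul_assoc, zero_add]
  have e3 : (T 0 : E) * ((ascProd T 1 m : Eˣ) * w * ((ascProd T 1 m : Eˣ) * w)) =
      (ascProd T 1 m : Eˣ) * w * ((ascProd T 1 m : Eˣ) * w) * T 0 := by
    rw [e1, ← mul_assoc, ← Units.val_mul, e2, Units.val_mul, mul_assoc, mul_assoc (Units.val _) (w * w), hw2]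
    simp only [Nat.add_sub_cancel]
  rw [e0, Units.inv_mul_cancel_left]
  generalize ((ascProd T 1 m : Eˣ) : E) * w = Z at *
  rw [Commute, SemiconjBy]
  calc (T 0 : E) * Z * (Z * ((T 0)⁻¹ : Eˣ)) = (T 0 : E) * (Z * Z) * ((T 0)⁻¹ : Eˣ) := by
        simp only [mul_assoc]
    _ = Z * Z := by rw [e3, Units.mul_inv_cancel_right]
    _ = _ := by rw [mul_assoc, Units.inv_mul_cancel_left]

theorem commute_cherednikElt
    (hc : ∀ k l, k + 1 < l → l + 1 < n → Commute (T k) (T l))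
    (hb : ∀ k, k + 2 < n → T k * T (k + 1) * T k = T (k + 1) * T k * T (k + 1))
    (hw : ∀ k, k + 2 < n → w * T (k + 1) = T k * w)
    (hw2 : 1 < n → w * w * T 0 = T (n - 2) * (w * w)) {i j : ℕ} (hi : i < n) (hj : j < n) :
    Commute (cherednikElt T w t n i) (cherednikElt T w t n j) := by
  wlog hij : i ≤ j generalizing i j
  · exact (this hj hi (by omega)).symm
  -- The generators `T_j` with `j ≥ 1` commute with element `0`, so the recursion carries
  -- commutation with it from element `1` to all later ones.
  have h0 : ∀ j < n, Commute (cherednikElt T w t n 0) (cherednikElt T w t n j) := by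
    intro j hj
    induction j with
    | zero => exact Commute.refl _
    | succ j ih =>
      rcases Nat.eq_zero_or_pos j with rfl | h
      · exact commute_cherednikElt_zero_one hc hb hw (hw2 hj) hj
      · have e : Commute (cherednikElt T w t n 0) ((T j)⁻¹ : Eˣ) :=
          (commute_cherednikElt_gen hc hb hw (by omega) hj (by omega)
            (by omega)).symm.units_inv_right
        rw [cherednikElt_succ hj]
        exact ((e.mul_right (ih (by omega))).mul_right e).smul_right _
  induction i with
  | zero => exact h0 j hj
  | succ i ih =>
    rcases hij.eq_or_lt with rfl | hij
    · exact Commute.refl _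
    · have e : Commute (((T i)⁻¹ : Eˣ) : E) (cherednikElt T w t n j) :=
        (commute_cherednikElt_gen hc hb hw hj (by omega) (by omega)
          (by omega)).units_inv_left
      rw [cherednikElt_succ (by omega)]
      exact ((e.mul_left (ih (by omega) (by omega))).mul_left e).smul_left _

end Algebra

/-! ### The operators as linear maps -/

/-- The generator `T_k` as a linear map. -/
def heckeEnd (N : ℕ) (t : ℝ) (k : ℕ) : Module.End ℝ (Poly N) :=
  if h : k + 1 < N then
    heckePair t ⟨k, (Nat.lt_succ_self k).trans h⟩ ⟨k + 1, h⟩ (by simp)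
  else 1

theorem heckeEnd_apply {N : ℕ} (t : ℝ) {k : ℕ} (h : k + 1 < N) (p : Poly N) :
    heckeEnd N t k p = heckeT t k p := by
  rw [heckeEnd, heckeT, dif_pos h, dif_pos h]
  simp only [heckePair, LinearMap.add_apply, LinearMap.smul_apply, smul_eq_C_mul,
    xDivDiff_apply, permVars_apply, swapVars, mul_assoc]

theorem heckeEnd_eq {N : ℕ} (t : ℝ) {k : ℕ} (h : k + 1 < N) :
    heckeEnd N t k = heckePair t ⟨k, (Nat.lt_succ_self k).trans h⟩ ⟨k + 1, h⟩ (by simp) :=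
  dif_pos h

/-- The generator `T_k` as an invertible linear map (the identity if `k + 1 ≥ N`). -/
def heckeUnit (N : ℕ) {t : ℝ} (ht : t ≠ 0) (k : ℕ) : (Module.End ℝ (Poly N))ˣ :=
  if h : k + 1 < N then
    { val := heckeEnd N t k
      inv := t⁻¹ • (heckeEnd N t k + (1 - t) • 1)
      val_inv := by
        rw [mul_smul_comm, mul_add, heckeEnd_eq t h, heckePair_quadratic, mul_smul_comm,
          mul_one, sub_add_cancel, smul_smul, inv_mul_cancel₀ ht, one_smul]
      inv_val := by
        rw [smul_mul_assoc, add_mul, heckeEnd_eq t h, heckePair_quadratic, smul_mul_assoc,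
          one_mul, sub_add_cancel, smul_smul, inv_mul_cancel₀ ht, one_smul] }
  else 1

theorem heckeUnit_val {N : ℕ} {t : ℝ} (ht : t ≠ 0) {k : ℕ} (h : k + 1 < N) :
    (heckeUnit N ht k : Module.End ℝ (Poly N)) = heckeEnd N t k := by
  rw [heckeUnit, dif_pos h]

theorem heckeUnit_inv {N : ℕ} {t : ℝ} (ht : t ≠ 0) {k : ℕ} (h : k + 1 < N) :
    (((heckeUnit N ht k)⁻¹ : (Module.End ℝ (Poly N))ˣ) : Module.End ℝ (Poly N)) =
      t⁻¹ • (heckeEnd N t k + (1 - t) • 1) := by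
  rw [heckeUnit, dif_pos h]
  rfl

theorem heckeUnit_inv_apply {N : ℕ} {t : ℝ} (ht : t ≠ 0) {k : ℕ} (h : k + 1 < N) (p : Poly N) :
    (((heckeUnit N ht k)⁻¹ : (Module.End ℝ (Poly N))ˣ) : Module.End ℝ (Poly N)) p =
      heckeTInv t k p := by
  rw [heckeUnit_inv ht h, heckeTInv, ← heckeEnd_apply t h]
  simp only [LinearMap.add_apply, LinearMap.smul_apply, smul_eq_C_mul, Module.End.one_apply]

/-- The images of the variables under the shift. -/
def shiftVar {N : ℕ} (q : ℝ) (i : Fin N) : Poly N :=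
  if (i : ℕ) = 0 then C q * X ⟨N - 1, by have := i.isLt; omega⟩
  else X ⟨(i : ℕ) - 1, by have := i.isLt; omega⟩

/-- The shift as a linear map. -/
def shiftEnd (N : ℕ) (q : ℝ) : Module.End ℝ (Poly N) :=
  (aeval (shiftVar q) : Poly N →ₐ[ℝ] Poly N).toLinearMap

theorem shiftEnd_apply {N : ℕ} (q : ℝ) (p : Poly N) : shiftEnd N q p = shift q p := rfl

/-- The generator is homogeneous of degree zero in its two variables, so a common scaling `c` of
both is harmless. This covers `w` with `c = 1` and `w²` with `c = q`; `w` alone would scale `x_0`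
but not `x_1`. -/
theorem algHom_mul_heckePair {N : ℕ} (t c : ℝ) (hc : c ≠ 0) (φ : Poly N →ₐ[ℝ] Poly N)
    {a b a' b' : Fin N} (h : a ≠ b) (h' : a' ≠ b') (ha : φ (X a) = C c * X a')
    (hb : φ (X b) = C c * X b')
    (hφ : ∀ x, x ≠ a → x ≠ b → rename (Equiv.swap a' b') (φ (X x)) = φ (X x)) :
    φ.toLinearMap * heckePair t a b h = heckePair t a' b' h' * φ.toLinearMap := by
  have key : ∀ p, φ (rename (Equiv.swap a b) p) = rename (Equiv.swap a' b') (φ p) := by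
    intro p
    have : φ.comp (rename (Equiv.swap a b)) = (rename (Equiv.swap a' b')).comp φ := by
      apply MvPolynomial.algHom_ext
      intro x
      simp only [AlgHom.comp_apply, rename_X]
      by_cases h1 : x = a
      · simp [h1, ha, hb]
      · by_cases h2 : x = b
        · simp [h2, ha, hb]
        · rw [Equiv.swap_apply_of_ne_of_ne h1 h2, hφ x h1 h2]
    exact DFunLike.congr_fun this p
  apply LinearMap.ext
  intro p
  have e := congrArg φ (mul_heckePair t h p)
  have e' := mul_heckePair t h' (φ p)
  simp only [map_mul, map_sub, map_add, map_one, ha, hb, key, algHom_C, algebraMap_eq] at e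
  have hcC : (C c : Poly N) ≠ 0 := by simpa using hc
  apply mul_left_cancel₀ (mul_ne_zero hcC (X_sub_X_ne_zero h'))
  simp only [Module.End.mul_apply, AlgHom.toLinearMap_apply]
  linear_combination e - C c * e'

theorem shiftEnd_mul_heckeEnd {N : ℕ} (q t : ℝ) {k : ℕ} (h : k + 2 < N) :
    shiftEnd N q * heckeEnd N t (k + 1) = heckeEnd N t k * shiftEnd N q := by
  rw [heckeEnd_eq t (show k + 1 + 1 < N from h), heckeEnd_eq t (show k + 1 < N by omega)]
  apply algHom_mul_heckePair t 1 one_ne_zero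
  · simp [shiftVar]
  · simp [shiftVar]
  · intro x h1 h2
    simp only [ne_eq, Fin.ext_iff] at h1 h2
    simp only [aeval_X, shiftVar]
    split_ifs with h0
    · rw [map_mul, rename_C, rename_X, Equiv.swap_apply_of_ne_of_ne] <;>
        simp only [ne_eq, Fin.ext_iff] <;> omega
    · rw [rename_X, Equiv.swap_apply_of_ne_of_ne] <;>
        simp only [ne_eq, Fin.ext_iff] <;> omega

theorem shiftEnd_sq_mul_heckeEnd {N : ℕ} {q : ℝ} (hq : q ≠ 0) (t : ℝ) (h : 1 < N) :
    shiftEnd N q * shiftEnd N q * heckeEnd N t 0 =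
      heckeEnd N t (N - 2) * (shiftEnd N q * shiftEnd N q) := by
  rw [heckeEnd_eq t (show 0 + 1 < N from h), heckeEnd_eq t (show N - 2 + 1 < N by omega)]
  have e : shiftEnd N q * shiftEnd N q =
    ((aeval (shiftVar q) : Poly N →ₐ[ℝ] Poly N).comp (aeval (shiftVar q))).toLinearMap := rfl
  rw [e]
  apply algHom_mul_heckePair t q hq
  · have h1 : N - 1 ≠ 0 := by omega
    simp [shiftVar, algHom_C, h1, Nat.sub_sub]
  · simp [shiftVar, Fin.ext_iff]
    omega
  · intro x h1 h2
    simp only [ne_eq, Fin.ext_iff] at h1 h2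
    have h3 : (x : ℕ) - 1 ≠ 0 := by omega
    simp only [AlgHom.comp_apply, aeval_X, shiftVar, if_neg h1, if_neg h3]
    rw [rename_X, Equiv.swap_apply_of_ne_of_ne] <;>
      simp only [ne_eq, Fin.ext_iff] <;> omega

/-- The Cherednik operators as linear maps. -/
def cherednikEnd {N : ℕ} (q : ℝ) {t : ℝ} (ht : t ≠ 0) (i : Fin N) : Module.End ℝ (Poly N) :=
  cherednikElt (heckeUnit N ht) (shiftEnd N q) t N i

theorem cherednikEnd_apply {N : ℕ} (q : ℝ) {t : ℝ} (ht : t ≠ 0) (i : Fin N) (f : Poly N) :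
    cherednikEnd q ht i f = cherednik q t i f := by
  have hi := i.isLt
  have h1 : ∀ m ≤ (i : ℕ), ∀ f, ((invProd (heckeUnit N ht) m : (Module.End ℝ (Poly N))ˣ) :
      Module.End ℝ (Poly N)) f = (List.range m).foldr (heckeTInv t) f := by
    intro m hm
    induction m with
    | zero => simp [invProd_zero]
    | succ m ih =>
      intro f
      rw [invProd_succ, Units.val_mul, Module.End.mul_apply, heckeUnit_inv_apply ht (by omega),
        ih (by omega), List.range_succ, List.foldr_append]
      rfl
  have h2 : ∀ m j, j + m < N → ∀ f, ((ascProd (heckeUnit N ht) j m :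
      (Module.End ℝ (Poly N))ˣ) : Module.End ℝ (Poly N)) f =
      (List.range' j m).foldr (heckeT t) f := by
    intro m
    induction m with
    | zero => simp [ascProd_zero]
    | succ m ih =>
      intro j hj f
      rw [ascProd_succ, Units.val_mul, Module.End.mul_apply, heckeUnit_val ht (by omega),
        heckeEnd_apply t (by omega), ih _ (by omega), List.range'_succ, List.foldr_cons]
  rw [cherednikEnd, cherednikElt, cherednik, LinearMap.smul_apply, Module.End.mul_apply,
    Module.End.mul_apply, h1 _ le_rfl, shiftEnd_apply, h2 _ _ (by omega), smul_eq_C_mul]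

theorem commute_cherednikEnd {N : ℕ} {q : ℝ} (hq : q ≠ 0) {t : ℝ} (ht : t ≠ 0) (i j : Fin N) :
    Commute (cherednikEnd q ht i) (cherednikEnd q ht j) := by
  apply commute_cherednikElt _ _ _ _ i.isLt j.isLt
  · intro k l hk hl
    apply Units.ext
    rw [Units.val_mul, Units.val_mul, heckeUnit_val ht (by omega), heckeUnit_val ht hl,
      heckeEnd_eq t (by omega), heckeEnd_eq t hl]
    apply heckePair_comm <;> simp only [ne_eq, Fin.ext_iff] <;> omega
  · intro k hk
    apply Units.ext
    simp only [Units.val_mul]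
    rw [heckeUnit_val ht (by omega), heckeUnit_val ht (by omega), heckeEnd_eq t (by omega),
      heckeEnd_eq t (by omega)]
    apply heckePair_braid
    simp only [ne_eq, Fin.ext_iff]
    omega
  · intro k hk
    rw [heckeUnit_val ht (by omega), heckeUnit_val ht (by omega), shiftEnd_mul_heckeEnd q t hk]
  · intro hN
    rw [heckeUnit_val ht (by omega), heckeUnit_val ht (by omega),
      shiftEnd_sq_mul_heckeEnd hq t hN]

/-! ### The order on compositions -/

theorem eq_of_sum_Iic_eq {N : ℕ} {α β : Comp N}
    (h : ∀ j, ∑ i ∈ Finset.Iic j, β i = ∑ i ∈ Finset.Iic j, α i) : β = α := by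
  funext j
  induction j using WellFoundedLT.induction with
  | _ j ih =>
    have e := h j
    rw [← Finset.Iio_insert, Finset.sum_insert (by simp), Finset.sum_insert (by simp),
      Finset.sum_congr rfl (fun i hi => ih i (Finset.mem_Iio.mp hi))] at e
    exact Nat.add_right_cancel e

theorem Dominates.trans {N : ℕ} {α β γ : Comp N} (h : Dominates α β) (h' : Dominates β γ) :
    Dominates α γ := by
  refine ⟨?_, fun j => (h'.2 j).trans (h.2 j)⟩
  rintro rfl
  exact h.1 (eq_of_sum_Iic_eq fun j => (h'.2 j).antisymm (h.2 j))

theorem Above.trans {N : ℕ} {α β γ : Comp N} (h : Above α β) (h' : Above β γ) : Above α γ := by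
  refine ⟨h.1.trans h'.1, ?_⟩
  rcases h with ⟨-, h | ⟨e, h⟩⟩ <;> rcases h' with ⟨-, h' | ⟨e', h'⟩⟩
  · exact Or.inl (h.trans h')
  · exact Or.inl (e' ▸ h)
  · exact Or.inl (e ▸ h')
  · exact Or.inr ⟨e.trans e', h.trans h'⟩

theorem Dominates.sum_lt {N : ℕ} {α β : Comp N} (h : Dominates α β) :
    ∑ j, ∑ i ∈ Finset.Iic j, β i < ∑ j, ∑ i ∈ Finset.Iic j, α i := by
  apply Finset.sum_lt_sum (fun j _ => h.2 j)
  by_contra hc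
  push Not at hc
  exact h.1 (eq_of_sum_Iic_eq fun j => (hc j (Finset.mem_univ j)).antisymm (h.2 j))

/-- A height on compositions along which `Above` is strictly increasing. -/
def height {N : ℕ} (α : Comp N) : ℕ ×ₗ ℕ :=
  toLex (∑ j, ∑ i ∈ Finset.Iic j, plus α i, ∑ j, ∑ i ∈ Finset.Iic j, α i)

theorem Above.height_lt {N : ℕ} {α β : Comp N} (h : Above α β) : height β < height α := by
  rw [height, height, Prod.Lex.toLex_lt_toLex]
  rcases h.2 with h | ⟨e, h⟩
  · exact Or.inl h.sum_lt
  · exact Or.inr ⟨by rw [e], h.sum_lt⟩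

theorem not_above_self {N : ℕ} (α : Comp N) : ¬ Above α α := fun h => lt_irrefl _ h.height_lt

theorem above_induction {N : ℕ} {P : Comp N → Prop}
    (h : ∀ α, (∀ β, Above α β → P β) → P α) (α : Comp N) : P α :=
  (InvImage.wf (height (N := N)) wellFounded_lt).induction α
    fun α ih => h α fun β hβ => ih β hβ.height_lt

theorem finite_above {N : ℕ} (α : Comp N) : {β | Above α β}.Finite := by
  apply (Set.finite_Iic (fun _ : Fin N => ∑ i, α i)).subset
  intro β hβ i
  rw [hβ.1]
  exact Finset.single_le_sum (f := β) (fun _ _ => Nat.zero_le _) (Finset.mem_univ i)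

theorem plus_comp_perm {N : ℕ} (α : Comp N) (σ : Equiv.Perm (Fin N)) :
    plus (α ∘ σ) = plus α := by
  have h := Tuple.unique_monotone (f := fun i => OrderDual.toDual (α i))
    (σ := σ * Tuple.sort (fun i => OrderDual.toDual (α (σ i))))
    (τ := Tuple.sort (fun i => OrderDual.toDual (α i)))
    (Tuple.monotone_sort (fun i => OrderDual.toDual (α (σ i))))
    (Tuple.monotone_sort (fun i => OrderDual.toDual (α i)))
  exact h

theorem sum_plus {N : ℕ} {M : Type*} [AddCommMonoid M] (α : Comp N) (g : ℕ → M) :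
    ∑ i, g (plus α i) = ∑ i, g (α i) :=
  Equiv.sum_comp (Tuple.sort fun i => OrderDual.toDual (α i)) (fun i => g (α i))

/-- Dominance of the rearrangements follows from the comparison of all truncated sums. -/
theorem dominates_plus {N : ℕ} {α β : Comp N} (h : ∀ c, ∑ i, (β i - c) ≤ ∑ i, (α i - c))
    (hne : plus α ≠ plus β) : Dominates (plus α) (plus β) := by
  refine ⟨hne, fun j => ?_⟩
  -- The sum of the `j` largest entries is at most `j c + ∑ (α_i - c)⁺` for every `c`, with equality
  -- when `c` is the `j`-th largest entry. Here `c` is chosen for equality at `α`.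
  set c := plus α j
  have hα : ∑ i ∈ Finset.Iic j, plus α i = ∑ i ∈ Finset.Iic j, c + ∑ i, (plus α i - c) := by
    have : ∑ i, (plus α i - c) = ∑ i ∈ Finset.Iic j, (plus α i - c) := by
      symm
      apply Finset.sum_subset (Finset.subset_univ _)
      intro i _ hi
      rw [Finset.mem_Iic, not_le] at hi
      exact Nat.sub_eq_zero_of_le (plus_antitone α hi.le)
    rw [this, ← Finset.sum_add_distrib]
    apply Finset.sum_congr rfl
    intro i hi
    have := plus_antitone α (Finset.mem_Iic.mp hi)
    omega
  have hβ : ∑ i ∈ Finset.Iic j, plus β i ≤ ∑ i ∈ Finset.Iic j, c + ∑ i, (plus β i - c) := by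
    calc ∑ i ∈ Finset.Iic j, plus β i ≤ ∑ i ∈ Finset.Iic j, (c + (plus β i - c)) :=
          Finset.sum_le_sum fun i _ => by omega
      _ ≤ _ := by
          rw [Finset.sum_add_distrib]
          exact Nat.add_le_add_left (Finset.sum_le_sum_of_subset (Finset.subset_univ _)) _
  have e := h c
  rw [← sum_plus β (· - c), ← sum_plus α (· - c)] at e
  omega

/-- The composition `α` with the entries at `a` and `b` replaced. -/
def setPair {N : ℕ} (α : Comp N) (a b : Fin N) (x y : ℕ) : Comp N :=
  Function.update (Function.update α a x) b y

theorem sum_setPair {N : ℕ} (α : Comp N) {a b : Fin N} (h : a ≠ b) (x y : ℕ) (g : ℕ → ℕ) :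
    ∑ i, g (setPair α a b x y i) + (g (α a) + g (α b)) = ∑ i, g (α i) + (g x + g y) := by
  have hb : b ∈ (Finset.univ : Finset (Fin N)).erase a := by simp [h.symm]
  have e : ∀ f : Fin N → ℕ, ∑ i, f i = f a + (f b + ∑ i ∈ (Finset.univ.erase a).erase b, f i) :=
    fun f => by
      rw [Finset.add_sum_erase _ _ hb, Finset.add_sum_erase _ _ (Finset.mem_univ a)]
  have e' : ∑ i ∈ (Finset.univ.erase a).erase b, g (setPair α a b x y i) =
      ∑ i ∈ (Finset.univ.erase a).erase b, g (α i) := by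
    apply Finset.sum_congr rfl
    intro i hi
    simp only [Finset.mem_erase] at hi
    simp [setPair, hi.1, hi.2.1]
  rw [e fun i => g (setPair α a b x y i), e fun i => g (α i), e']
  simp only [setPair, Function.update_self, Function.update_of_ne h]
  omega

/-- Moving two entries towards each other with fixed sum does not increase the sums of the convex
functions `(· - c)⁺`, and strictly decreases the sum of squares, so the rearrangement really
changes. -/
theorem above_setPair {N : ℕ} (α : Comp N) {a b : Fin N} (h : a ≠ b) {x y : ℕ}
    (hs : x + y = α a + α b)
    (hxy : (α a < x ∧ α a < y) ∨ (α b < x ∧ α b < y)) :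
    Above α (setPair α a b x y) := by
  refine ⟨?_, Or.inl (dominates_plus ?_ ?_)⟩
  · have := sum_setPair α h x y id
    simp only [id] at this
    omega
  · intro c
    have := sum_setPair α h x y (· - c)
    omega
  · intro e
    have := sum_setPair α h x y (· ^ 2)
    have e1 := sum_plus α (· ^ 2)
    have e1' := sum_plus (setPair α a b x y) (· ^ 2)
    rw [e] at e1
    have e2 : α a ^ 2 + α b ^ 2 = x ^ 2 + y ^ 2 := by omega
    zify at *
    rcases hxy with ⟨h1, h2⟩ | ⟨h1, h2⟩
    · have : (α b : ℤ) = x + y - α a := by linarith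
      rw [this] at e2
      nlinarith [mul_pos (sub_pos.mpr h1) (sub_pos.mpr h2)]
    · have : (α a : ℤ) = x + y - α b := by linarith
      rw [this] at e2
      nlinarith [mul_pos (sub_pos.mpr h1) (sub_pos.mpr h2)]

theorem above_swap {N : ℕ} (α : Comp N) {a b : Fin N} (hab : a < b) (h : α b < α a) :
    Above α (setPair α a b (α b) (α a)) := by
  have e : setPair α a b (α b) (α a) = α ∘ Equiv.swap a b := by
    funext i
    simp only [setPair, Function.comp_apply, Equiv.swap_apply_def, Function.update_apply]
    split_ifs <;> simp_all
  rw [e]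
  refine ⟨(Equiv.sum_comp (Equiv.swap a b) α).symm, Or.inr ⟨(plus_comp_perm α _).symm, ?_, ?_⟩⟩
  · intro e
    have := congrFun e a
    simp only [Function.comp_apply, Equiv.swap_apply_left] at this
    omega
  · intro j
    by_cases hb : b ≤ j
    · apply le_of_eq
      apply Finset.sum_equiv (Equiv.swap a b)
      · intro i
        simp only [Finset.mem_Iic, Equiv.swap_apply_def]
        split_ifs with h1 h2
        · rw [h1]; exact ⟨fun _ => hb, fun _ => hab.le.trans hb⟩
        · rw [h2]; exact ⟨fun _ => hab.le.trans hb, fun _ => hb⟩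
        · rfl
      · intro i _
        rfl
    · apply Finset.sum_le_sum
      intro i hi
      have hib : i ≠ b := fun h => hb (h ▸ Finset.mem_Iic.mp hi)
      by_cases hia : i = a
      · rw [hia, Function.comp_apply, Equiv.swap_apply_left]
        exact h.le
      · rw [Function.comp_apply, Equiv.swap_apply_of_ne_of_ne hia hib]

/-! ### Triangularity of the Cherednik operators -/

/-- The monomial `x^α`. -/
def mono {N : ℕ} (α : Comp N) : Poly N := monomial (Finsupp.equivFunOnFinite.symm α) 1

theorem coeff_mono {N : ℕ} (α β : Comp N) :
    coeff (Finsupp.equivFunOnFinite.symm β) (mono α) = if α = β then 1 else 0 := by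
  rw [mono, coeff_monomial]
  simp only [EmbeddingLike.apply_eq_iff_eq]

theorem span_mono {N : ℕ} : Submodule.span ℝ (Set.range (mono (N := N))) = ⊤ := by
  have h := (basisMonomials (Fin N) ℝ).span_eq
  rw [← h]
  congr 1
  rw [← Finsupp.equivFunOnFinite.symm.surjective.range_comp, coe_basisMonomials]
  rfl

/-- The span of the monomials strictly below `α`. -/
def below {N : ℕ} (α : Comp N) : Submodule ℝ (Poly N) :=
  Submodule.span ℝ (mono '' {β | Above α β})

theorem mono_mem_below {N : ℕ} {α β : Comp N} (h : Above α β) : mono β ∈ below α :=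
  Submodule.subset_span ⟨β, h, rfl⟩

theorem below_le {N : ℕ} {α β : Comp N} (h : Above α β) : below β ≤ below α :=
  Submodule.span_mono (Set.image_mono fun _ h' => h.trans h')

theorem above_of_mem_below {N : ℕ} {α β : Comp N} {p : Poly N} (hp : p ∈ below α)
    (hβ : coeff (Finsupp.equivFunOnFinite.symm β) p ≠ 0) : Above α β := by
  by_contra hc
  apply hβ
  have : below α ≤ LinearMap.ker (lcoeff ℝ (Finsupp.equivFunOnFinite.symm β)) := by
    rw [below, Submodule.span_le]
    rintro _ ⟨γ, hγ, rfl⟩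
    rw [SetLike.mem_coe, LinearMap.mem_ker, lcoeff_apply, coeff_mono, if_neg]
    rintro rfl
    exact hc hγ
  exact this hp

/-- `A` is triangular on monomials, with diagonal entries `d`. -/
def IsTri {N : ℕ} (A : Module.End ℝ (Poly N)) (d : Comp N → ℝ) : Prop :=
  ∀ α, A (mono α) - d α • mono α ∈ below α

theorem IsTri.maps_below {N : ℕ} {A : Module.End ℝ (Poly N)} {d : Comp N → ℝ} (h : IsTri A d)
    {α : Comp N} {p : Poly N} (hp : p ∈ below α) : A p ∈ below α := by
  have : below α ≤ (below α).comap A := by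
    conv_lhs => rw [below]
    rw [Submodule.span_le]
    rintro _ ⟨β, hβ, rfl⟩
    have := add_mem (below_le hβ (h β)) ((below α).smul_mem (d β) (mono_mem_below hβ))
    rwa [sub_add_cancel] at this
  exact this hp

theorem IsTri.mul {N : ℕ} {A B : Module.End ℝ (Poly N)} {d e : Comp N → ℝ} (h : IsTri A d)
    (h' : IsTri B e) : IsTri (A * B) (fun α => d α * e α) := by
  intro α
  have := add_mem (h.maps_below (h' α)) ((below α).smul_mem (e α) (h α))
  rw [map_sub, map_smul, smul_sub, sub_add_sub_cancel, smul_smul, mul_comm] at this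
  exact this

theorem IsTri.add {N : ℕ} {A B : Module.End ℝ (Poly N)} {d e : Comp N → ℝ} (h : IsTri A d)
    (h' : IsTri B e) : IsTri (A + B) (fun α => d α + e α) := by
  intro α
  have := add_mem (h α) (h' α)
  rwa [sub_add_sub_comm, ← add_smul] at this

theorem IsTri.smul {N : ℕ} {A : Module.End ℝ (Poly N)} {d : Comp N → ℝ} (h : IsTri A d)
    (c : ℝ) : IsTri (c • A) (fun α => c * d α) := by
  intro α
  have := (below α).smul_mem c (h α)
  rwa [smul_sub, smul_smul] at this

theorem isTri_one {N : ℕ} : IsTri (1 : Module.End ℝ (Poly N)) (fun _ => 1) := by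
  intro α
  simp

theorem IsTri.congr {N : ℕ} {A B : Module.End ℝ (Poly N)} {d e : Comp N → ℝ} (h : IsTri A d)
    (hA : A = B) (hd : ∀ α, d α = e α) : IsTri B e :=
  hA ▸ (funext hd : d = e) ▸ h

theorem rename_mono {N : ℕ} (σ : Equiv.Perm (Fin N)) (α : Comp N) :
    rename σ (mono α) = mono (α ∘ σ.symm) := by
  rw [mono, mono, rename_monomial]
  refine congrArg (fun s => monomial s (1 : ℝ)) (Finsupp.ext fun x => ?_)
  rw [Finsupp.mapDomain_equiv_apply]
  rfl

theorem mono_setPair {N : ℕ} (α : Comp N) {a b : Fin N} (h : a ≠ b) (x y : ℕ) :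
    mono (setPair α a b x y) = mono (setPair α a b 0 0) * X a ^ x * X b ^ y := by
  rw [mono, mono, X_pow_eq_monomial, X_pow_eq_monomial, monomial_mul, monomial_mul]
  simp only [mul_one]
  refine congrArg (fun s => monomial s (1 : ℝ)) (Finsupp.ext fun i => ?_)
  simp only [Finsupp.coe_add, Pi.add_apply, Finsupp.equivFunOnFinite_symm_apply_apply, setPair,
    Finsupp.single_apply, Function.update_apply]
  by_cases h1 : i = b
  · simp [h1, h]
  · by_cases h2 : i = a
    · simp [h2, h, h.symm]
    · simp [h1, h2, Ne.symm h1, Ne.symm h2]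

theorem setPair_self {N : ℕ} (α : Comp N) (a b : Fin N) : setPair α a b (α a) (α b) = α := by
  simp [setPair]

theorem setPair_swap {N : ℕ} (α : Comp N) (a b : Fin N) :
    α ∘ Equiv.swap a b = setPair α a b (α b) (α a) := by
  funext i
  simp only [setPair, Function.comp_apply, Equiv.swap_apply_def, Function.update_apply]
  split_ifs <;> simp_all

theorem mul_sum_mono_setPair {N : ℕ} (α : Comp N) {a b : Fin N} (h : a ≠ b) (e m : ℕ) :
    (X a - X b) * ∑ k ∈ Finset.range m, mono (setPair α a b (e + k) (e + m - k)) =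
      X b * (mono (setPair α a b (e + m) e) - mono (setPair α a b e (e + m))) := by
  have e1 : ∑ k ∈ Finset.range m, mono (setPair α a b (e + k) (e + m - k)) =
      mono (setPair α a b 0 0) * X a ^ e * X b ^ e * X b *
        ∑ k ∈ Finset.range m, X a ^ k * X b ^ (m - 1 - k) := by
    rw [Finset.mul_sum]
    apply Finset.sum_congr rfl
    intro k hk
    rw [Finset.mem_range] at hk
    rw [mono_setPair α h, show e + m - k = e + 1 + (m - 1 - k) by omega]
    ring
  have e2 := geom_sum₂_mul (X a : Poly N) (X b) m
  rw [e1, mono_setPair α h (e + m), mono_setPair α h e]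
  linear_combination mono (setPair α a b 0 0) * X a ^ e * X b ^ e * X b * e2

/-- The quotient is a geometric sum whose exponent pairs run between `α` and its swap, and the
factor `x_b` decides which end is included: always the one with the larger exponent at `b`. That end
is `x^α` itself, with coefficient `-1`, if `α a < α b`, and otherwise the swap, which lies below `α`
because `a < b`. Interior terms are below `α` by `above_setPair`. -/
theorem isTri_xDivDiff {N : ℕ} {a b : Fin N} (h : a < b) :
    IsTri (xDivDiff a b h.ne) (fun α => if α a < α b then -1 else 0) := by
  intro α
  have key := mul_xDivDiff h.ne (mono α)
  rw [rename_mono, Equiv.symm_swap, setPair_swap] at key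
  beta_reduce
  split_ifs with hα
  · obtain ⟨m, hm⟩ : ∃ m, α b = α a + (m + 1) := ⟨α b - α a - 1, by omega⟩
    have e : xDivDiff a b h.ne (mono α) =
        - ∑ k ∈ Finset.range (m + 1), mono (setPair α a b (α a + k) (α a + (m + 1) - k)) := by
      apply mul_left_cancel₀ (X_sub_X_ne_zero h.ne)
      rw [key, mul_neg, mul_sum_mono_setPair α h.ne, ← hm, setPair_self]
      ring
    rw [e, Finset.sum_range_succ', add_zero, Nat.sub_zero, ← hm, setPair_self, neg_add,
      neg_one_smul, sub_neg_eq_add, neg_add_cancel_right, neg_mem_iff]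
    apply Submodule.sum_mem
    intro k hk
    rw [Finset.mem_range] at hk
    exact mono_mem_below (above_setPair α h.ne (by omega) (Or.inl (by omega)))
  · obtain ⟨m, hm⟩ : ∃ m, α a = α b + m := ⟨α a - α b, by omega⟩
    have e : xDivDiff a b h.ne (mono α) =
        ∑ k ∈ Finset.range m, mono (setPair α a b (α b + k) (α b + m - k)) := by
      apply mul_left_cancel₀ (X_sub_X_ne_zero h.ne)
      rw [key, mul_sum_mono_setPair α h.ne, ← hm, setPair_self]
    rw [e, zero_smul, sub_zero]
    apply Submodule.sum_mem
    intro k hk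
    rw [Finset.mem_range] at hk
    rcases Nat.eq_zero_or_pos k with rfl | hk0
    · rw [add_zero, Nat.sub_zero, ← hm]
      exact mono_mem_below (above_swap α h (by omega))
    · exact mono_mem_below (above_setPair α h.ne (by omega) (Or.inr (by omega)))

theorem permVars_swap_mul_xDivDiff {N : ℕ} {a b : Fin N} (h : a ≠ b) :
    permVars (Equiv.swap a b) * xDivDiff a b h =
      xDivDiff a b h + 1 - permVars (Equiv.swap a b) := by
  apply LinearMap.ext
  intro p
  have e := mul_xDivDiff h p
  have e' := congrArg (rename (Equiv.swap a b) : Poly N →ₐ[ℝ] Poly N) e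
  have e2 := swapVars_swapVars a b p
  simp only [swapVars] at e2
  simp only [map_mul, map_sub, rename_X, e2, Equiv.swap_apply_left, Equiv.swap_apply_right] at e'
  apply mul_left_cancel₀ (X_sub_X_ne_zero h)
  simp only [Module.End.mul_apply, permVars_apply, LinearMap.sub_apply, LinearMap.add_apply,
    Module.End.one_apply]
  linear_combination - e' - e

theorem xDivDiff_mul_permVars_swap {N : ℕ} {a b : Fin N} (h : a ≠ b) :
    xDivDiff a b h * permVars (Equiv.swap a b) = - xDivDiff a b h := by
  apply LinearMap.ext
  intro p
  have e := mul_xDivDiff h p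
  have e' := mul_xDivDiff h (rename (Equiv.swap a b) p)
  have e2 := swapVars_swapVars a b p
  simp only [swapVars] at e2
  rw [e2] at e'
  apply mul_left_cancel₀ (X_sub_X_ne_zero h)
  simp only [Module.End.mul_apply, permVars_apply, LinearMap.neg_apply]
  linear_combination e' + e

/-- The triangular factor of the generator `T`, so that `T` is this map after the swap. -/
def triFactor {N : ℕ} (t : ℝ) (a b : Fin N) (h : a ≠ b) : Module.End ℝ (Poly N) :=
  t • 1 + (-(1 - t)) • xDivDiff a b h

/-- The inverse of `triFactor`. -/
def triFactorInv {N : ℕ} (t : ℝ) (a b : Fin N) (h : a ≠ b) : Module.End ℝ (Poly N) :=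
  t⁻¹ • (1 + (1 - t) • xDivDiff a b h)

/-- The generator itself is not triangular, as its swap can move a composition upwards. Splitting
the swap off lets all swaps be collected around `w`, leaving only triangular factors outside. -/
theorem heckePair_eq {N : ℕ} (t : ℝ) {a b : Fin N} (h : a ≠ b) :
    heckePair t a b h = triFactor t a b h * permVars (Equiv.swap a b) := by
  rw [triFactor, add_mul, smul_mul_assoc, smul_mul_assoc, xDivDiff_mul_permVars_swap, one_mul,
    neg_smul_neg, heckePair, add_comm]

theorem heckePair_inv_eq {N : ℕ} (t : ℝ) {a b : Fin N} (h : a ≠ b) :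
    t⁻¹ • (heckePair t a b h + (1 - t) • 1) =
      permVars (Equiv.swap a b) * triFactorInv t a b h := by
  rw [triFactorInv, mul_smul_comm, mul_add, mul_smul_comm, permVars_swap_mul_xDivDiff, heckePair,
    mul_one]
  module

theorem permVars_mul_triFactor {N : ℕ} (t : ℝ) (σ : Equiv.Perm (Fin N)) {a b a' b' : Fin N}
    (h : a ≠ b) (h' : a' ≠ b') (ha : σ a = a') (hb : σ b = b') :
    permVars σ * triFactor t a b h = triFactor t a' b' h' * permVars σ := by
  subst ha hb
  simp only [triFactor, mul_add, add_mul, mul_smul_comm, smul_mul_assoc,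
    permVars_mul_xDivDiff, mul_one, one_mul]

theorem permVars_mul_triFactorInv {N : ℕ} (t : ℝ) (σ : Equiv.Perm (Fin N)) {a b a' b' : Fin N}
    (h : a ≠ b) (h' : a' ≠ b') (ha : σ a = a') (hb : σ b = b') :
    permVars σ * triFactorInv t a b h = triFactorInv t a' b' h' * permVars σ := by
  subst ha hb
  simp only [triFactorInv, mul_add, add_mul, mul_smul_comm, smul_mul_assoc,
    permVars_mul_xDivDiff, mul_one, one_mul]

theorem isTri_triFactor {N : ℕ} (t : ℝ) {a b : Fin N} (h : a < b) :
    IsTri (triFactor t a b h.ne) (fun α => if α a < α b then 1 else t) := by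
  refine ((isTri_one.smul t).add ((isTri_xDivDiff h).smul _)).congr rfl fun α => ?_
  split_ifs <;> ring

theorem isTri_triFactorInv {N : ℕ} {t : ℝ} (ht : t ≠ 0) {a b : Fin N} (h : a < b) :
    IsTri (triFactorInv t a b h.ne) (fun α => if α a < α b then 1 else t⁻¹) := by
  refine ((isTri_one.add ((isTri_xDivDiff h).smul _)).smul _).congr rfl fun α => ?_
  split_ifs <;> field_simp <;> ring

/-- Pushing the swaps to the right turns the factor of each generator into one for a pair `(i, k)`
with `i < k`, which is the orientation needed for triangularity. What remains on the right is a
cycle. -/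
theorem ascProd_heckeUnit_eq {N : ℕ} {t : ℝ} (ht : t ≠ 0) (i : Fin N) (m : ℕ)
    (hm : (i : ℕ) + m < N) :
    ∃ (A : Module.End ℝ (Poly N)) (c : Equiv.Perm (Fin N)),
      IsTri A (fun α => ∏ k ∈ Finset.univ.filter (fun k : Fin N => i < k ∧ (k : ℕ) ≤ i + m),
        if α i < α k then 1 else t) ∧
      (∀ j, (c j : ℕ) = if (j : ℕ) < i then (j : ℕ) else if (j : ℕ) < i + m then (j : ℕ) + 1
        else if (j : ℕ) = i + m then (i : ℕ) else (j : ℕ)) ∧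
      ((ascProd (heckeUnit N ht) i m : (Module.End ℝ (Poly N))ˣ) : Module.End ℝ (Poly N)) =
        A * permVars c := by
  induction m with
  | zero =>
    refine ⟨1, 1, isTri_one.congr rfl fun α => ?_, ?_, ?_⟩
    · rw [Finset.filter_false_of_mem, Finset.prod_empty]
      intro k _ hk
      have := Fin.lt_def.mp hk.1
      omega
    · intro j
      rw [Equiv.Perm.one_apply]
      split_ifs <;> omega
    · rw [ascProd_zero, permVars_one, Units.val_one, mul_one]
  | succ m ih =>
    obtain ⟨A, c, hA, hc, e⟩ := ih (by omega)
    have hm' : (i : ℕ) + m + 1 < N := by omega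
    have hlt : i < ⟨i + m + 1, hm'⟩ := Fin.lt_def.mpr (by simp only; omega)
    have c1 : c ⟨i + m, by omega⟩ = i := by
      apply Fin.ext
      rw [hc]
      simp
    have c2 : c ⟨i + m + 1, hm'⟩ = ⟨i + m + 1, hm'⟩ := by
      apply Fin.ext
      rw [hc]
      simp only
      split_ifs <;> omega
    refine ⟨A * triFactor t i ⟨i + m + 1, hm'⟩ hlt.ne,
      c * Equiv.swap ⟨i + m, by omega⟩ ⟨i + m + 1, hm'⟩,
      (hA.mul (isTri_triFactor t hlt)).congr rfl fun α => ?_, ?_, ?_⟩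
    · have : Finset.univ.filter (fun k : Fin N => i < k ∧ (k : ℕ) ≤ i + (m + 1)) =
          insert ⟨i + m + 1, hm'⟩
            (Finset.univ.filter (fun k : Fin N => i < k ∧ (k : ℕ) ≤ i + m)) := by
        ext k
        simp only [Finset.mem_filter, Finset.mem_univ, true_and, Finset.mem_insert, Fin.lt_def,
          Fin.ext_iff]
        omega
      rw [this, Finset.prod_insert (by simp), mul_comm]
    · intro j
      rw [Equiv.Perm.mul_apply]
      by_cases h1 : j = ⟨i + m, by omega⟩
      · rw [h1, Equiv.swap_apply_left, c2]
        simp only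
        split_ifs <;> omega
      · by_cases h2 : j = ⟨i + m + 1, hm'⟩
        · rw [h2, Equiv.swap_apply_right, c1]
          simp only
          split_ifs <;> omega
        · rw [Equiv.swap_apply_of_ne_of_ne h1 h2, hc]
          rw [Fin.ext_iff] at h1 h2
          split_ifs <;> simp only at h1 h2 <;> omega
    · rw [ascProd_succ', Units.val_mul, e, heckeUnit_val ht hm', heckeEnd_eq t hm', heckePair_eq,
        mul_assoc, ← mul_assoc (permVars c), permVars_mul_triFactor t c _ hlt.ne c1 c2, permVars_mul]
      simp only [mul_assoc]

/-- Here the swaps are pushed to the left. The quotient is the tail `T_m⁻¹ ⋯ T_{i-1}⁻¹`, so the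
induction can add factors at the left end. -/
theorem invProd_heckeUnit_eq {N : ℕ} {t : ℝ} (ht : t ≠ 0) (i : Fin N) (m l : ℕ)
    (hm : m + l = i) :
    ∃ (A : Module.End ℝ (Poly N)) (c : Equiv.Perm (Fin N)),
      IsTri A (fun α => ∏ k ∈ Finset.univ.filter (fun k : Fin N => m ≤ (k : ℕ) ∧ k < i),
        if α k < α i then 1 else t⁻¹) ∧
      (∀ j, (c j : ℕ) = if (j : ℕ) < m then (j : ℕ) else if (j : ℕ) < i then (j : ℕ) + 1
        else if (j : ℕ) = i then m else (j : ℕ)) ∧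
      (((invProd (heckeUnit N ht) m)⁻¹ * invProd (heckeUnit N ht) i :
        (Module.End ℝ (Poly N))ˣ) : Module.End ℝ (Poly N)) = permVars c * A := by
  have hi := i.isLt
  induction l generalizing m with
  | zero =>
    refine ⟨1, 1, isTri_one.congr rfl fun α => ?_, ?_, ?_⟩
    · rw [Finset.filter_false_of_mem, Finset.prod_empty]
      intro k _ hk
      have := Fin.lt_def.mp hk.2
      omega
    · intro j
      rw [Equiv.Perm.one_apply]
      split_ifs <;> omega
    · rw [← hm, add_zero, inv_mul_cancel, permVars_one, Units.val_one, mul_one]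
  | succ l ih =>
    obtain ⟨A, c, hA, hc, e⟩ := ih (m + 1) (by omega)
    have hm' : m + 1 < N := by omega
    have hlt : (⟨m, by omega⟩ : Fin N) < i := Fin.lt_def.mpr (by simp only; omega)
    have c1 : c ⟨m, by omega⟩ = ⟨m, by omega⟩ := by
      apply Fin.ext
      rw [hc]
      simp
    have c2 : c i = ⟨m + 1, hm'⟩ := by
      apply Fin.ext
      rw [hc]
      simp only
      split_ifs <;> omega
    refine ⟨triFactorInv t ⟨m, by omega⟩ i hlt.ne * A,
      Equiv.swap ⟨m, by omega⟩ ⟨m + 1, hm'⟩ * c,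
      ((isTri_triFactorInv ht hlt).mul hA).congr rfl fun α => ?_, ?_, ?_⟩
    · have : Finset.univ.filter (fun k : Fin N => m ≤ (k : ℕ) ∧ k < i) =
          insert ⟨m, by omega⟩
            (Finset.univ.filter (fun k : Fin N => m + 1 ≤ (k : ℕ) ∧ k < i)) := by
        ext k
        simp only [Finset.mem_filter, Finset.mem_univ, true_and, Finset.mem_insert, Fin.lt_def,
          Fin.ext_iff]
        omega
      rw [this, Finset.prod_insert (by simp)]
    · intro j
      have hj := hc j
      rw [Equiv.Perm.mul_apply]
      by_cases h1 : c j = ⟨m, by omega⟩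
      · rw [h1, Equiv.swap_apply_left]
        rw [h1] at hj
        simp only at hj ⊢
        split_ifs at hj ⊢ <;> omega
      · by_cases h2 : c j = ⟨m + 1, hm'⟩
        · rw [h2, Equiv.swap_apply_right]
          rw [h2] at hj
          simp only at hj ⊢
          split_ifs at hj ⊢ <;> omega
        · rw [Equiv.swap_apply_of_ne_of_ne h1 h2]
          rw [Fin.ext_iff] at h1 h2
          simp only at h1 h2
          split_ifs at hj ⊢ <;> omega
    · have e1 : (invProd (heckeUnit N ht) m)⁻¹ * invProd (heckeUnit N ht) i =
          (heckeUnit N ht m)⁻¹ *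
            ((invProd (heckeUnit N ht) (m + 1))⁻¹ * invProd (heckeUnit N ht) i) := by
        rw [invProd_succ]
        group
      rw [e1, Units.val_mul, e, heckeUnit_inv ht hm', heckeEnd_eq t hm', heckePair_inv_eq,
        permVars_mul, mul_assoc, mul_assoc, ← mul_assoc (permVars c),
        permVars_mul_triFactorInv t c hlt.ne (by simp) c1 c2]
      simp only [mul_assoc]

theorem isTri_scale {N : ℕ} {q : ℝ} {i : Fin N} {A : Module.End ℝ (Poly N)}
    (φ : Poly N →ₐ[ℝ] Poly N) (hA : A = φ.toLinearMap)
    (h : ∀ j, φ (X j) = (if j = i then C q else 1) * X j) :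
    IsTri A (fun α => q ^ α i) := by
  intro α
  have e : A (mono α) = q ^ α i • mono α := by
    rw [hA, AlgHom.toLinearMap_apply, mono, monomial_eq, C_1, one_mul,
      Finsupp.prod_fintype _ _ (fun _ => pow_zero _), map_prod]
    simp only [map_pow, h, mul_pow, Finset.prod_mul_distrib, ite_pow, one_pow,
      Finset.prod_ite_eq', Finset.mem_univ, if_true, smul_eq_C_mul,
      Finsupp.equivFunOnFinite_symm_apply_apply]
  rw [e, sub_self]
  exact zero_mem _

theorem prod_ite_one {ι : Type*} (s : Finset ι) (P : ι → Prop) [DecidablePred P] (x : ℝ) :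
    (∏ k ∈ s, if P k then 1 else x) = x ^ (s.filter fun k => ¬ P k).card := by
  rw [Finset.prod_ite, Finset.prod_const_one, one_mul, Finset.prod_const]

/-- The exponent of `t` on the diagonal of `ξ_i` equals `N - r_α(i)`; it is checked by counting the
contribution of each position `k`. -/
theorem card_rank {N : ℕ} (α : Comp N) (i : Fin N) :
    (i : ℕ) + (Finset.univ.filter fun k => i < k ∧ ¬ α i < α k).card + rank α i =
      N + (Finset.univ.filter fun k => k < i ∧ ¬ α k < α i).card := by
  have h1 : (i : ℕ) = (Finset.univ.filter fun k => k < i).card := by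
    rw [Finset.filter_gt_eq_Iio, Fin.card_Iio]
  have h2 : N = ∑ _k : Fin N, 1 := by simp
  rw [rank]
  nth_rewrite 1 [h1]
  have h3 : N + (Finset.univ.filter fun k => k < i ∧ ¬ α k < α i).card =
      ∑ _k : Fin N, 1 + (Finset.univ.filter fun k => k < i ∧ ¬ α k < α i).card := by
    rw [← h2]
  rw [h3]
  simp only [Finset.card_filter, ← Finset.sum_add_distrib]
  apply Finset.sum_congr rfl
  intro k _
  have hk : k = i → α k = α i := fun h => congrArg α h
  simp only [Fin.lt_def, Fin.le_def]
  rw [Fin.ext_iff] at hk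
  split_ifs <;> omega

theorem isTri_cherednikEnd {N : ℕ} (q : ℝ) {t : ℝ} (ht : t ≠ 0) (i : Fin N) :
    IsTri (cherednikEnd q ht i) (fun α => spectral q t α i) := by
  have hi := i.isLt
  obtain ⟨A, c, hA, hc, e⟩ := ascProd_heckeUnit_eq ht i (N - 1 - i) (by omega)
  obtain ⟨B, d, hB, hd, e'⟩ := invProd_heckeUnit_eq ht i 0 i (by omega)
  rw [invProd_zero, inv_one, one_mul] at e'
  -- The two cycles and the cyclic shift cancel, leaving only the scaling of `x_i` by `q`.
  have hS : IsTri (permVars c * shiftEnd N q * permVars d) (fun α => q ^ α i) := by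
    apply isTri_scale
      (((rename c).comp (aeval (shiftVar q) : Poly N →ₐ[ℝ] Poly N)).comp (rename d)) rfl
    intro j
    have hj := j.isLt
    have hdj := hd j
    simp only [AlgHom.comp_apply, rename_X, aeval_X, shiftVar]
    rcases eq_or_ne j i with rfl | hji
    · have h0 : (d j : ℕ) = 0 := by rw [hdj]; simp
      rw [if_pos h0, if_pos rfl, map_mul, rename_C, rename_X]
      congr 2
      apply Fin.ext
      rw [hc]
      simp only
      split_ifs <;> omega
    · have hji' : (j : ℕ) ≠ i := fun h => hji (Fin.ext h)
      have h0 : (d j : ℕ) ≠ 0 := by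
        rw [hdj]
        split_ifs <;> omega
      rw [if_neg h0, if_neg hji, one_mul, rename_X]
      congr 1
      apply Fin.ext
      rw [hc]
      simp only [hdj]
      split_ifs <;> omega
  refine (((hA.mul hS).mul hB).smul (t ^ (i : ℕ))).congr ?_ fun α => ?_
  · rw [cherednikEnd, cherednikElt, e, e']
    simp only [mul_assoc]
  · have f1 : (Finset.univ.filter fun k : Fin N => i < k ∧ (k : ℕ) ≤ i + (N - 1 - i)) =
        Finset.univ.filter fun k : Fin N => i < k := by
      apply Finset.filter_congr
      intro k _
      have := k.isLt
      constructor
      · exact fun h => h.1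
      · exact fun h => ⟨h, by omega⟩
    have f2 : (Finset.univ.filter fun k : Fin N => 0 ≤ (k : ℕ) ∧ k < i) =
        Finset.univ.filter fun k : Fin N => k < i := by simp
    rw [f1, f2, prod_ite_one, prod_ite_one, Finset.filter_filter, Finset.filter_filter, spectral,
      inv_pow, ← zpow_natCast t, ← zpow_natCast t, ← zpow_natCast t, ← zpow_neg]
    have := card_rank α i
    rw [show (N : ℤ) - (rank α i : ℤ) = (i : ℕ) +
      ((Finset.univ.filter fun k => i < k ∧ ¬ α i < α k).card : ℤ) +
      -((Finset.univ.filter fun k => k < i ∧ ¬ α k < α i).card : ℤ) by omega,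
      zpow_add₀ ht, zpow_add₀ ht]
    ring

/-! ### Separation of the spectral vectors -/

theorem zpow_mul_zpow_lt_one {N : ℕ} {q t : ℝ} (hq : 0 < q) (ht : 0 < t) (hq1 : q < 1)
    (hqt : q * t ^ N < 1) {a m : ℤ} (ha : 1 ≤ a) (hm : 0 ≤ m) (hmN : m ≤ N) :
    q ^ a * t ^ m < 1 := by
  have h1 : q ^ a ≤ q := by
    simpa using zpow_le_zpow_right_of_le_one₀ hq hq1.le ha
  rcases le_total t 1 with h | h
  · have h2 : t ^ m ≤ 1 := by
      simpa using zpow_le_zpow_right_of_le_one₀ ht h hm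
    calc q ^ a * t ^ m ≤ q * 1 := by gcongr
      _ < 1 := by rwa [mul_one]
  · have h2 : t ^ m ≤ t ^ N := by
      simpa using zpow_le_zpow_right₀ h hmN
    calc q ^ a * t ^ m ≤ q * t ^ N := by gcongr
      _ < 1 := hqt

theorem one_sub_mul_one_sub_pos {N : ℕ} {q t : ℝ} (hq : 0 < q) (ht : 0 < t)
    (hqt : (q < 1 ∧ q * t ^ N < 1) ∨ (1 < q ∧ 1 < q * t ^ N)) {a m : ℤ} (ha : 1 ≤ a)
    (hm : 0 ≤ m) (hmN : m ≤ N) : 0 < (1 - q ^ a * t ^ m) * (1 - q) := by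
  rcases hqt with ⟨h1, h2⟩ | ⟨h1, h2⟩
  · exact mul_pos (sub_pos.mpr (zpow_mul_zpow_lt_one hq ht h1 h2 ha hm hmN)) (sub_pos.mpr h1)
  · apply mul_pos_of_neg_of_neg
    · have := zpow_mul_zpow_lt_one (N := N) (inv_pos.mpr hq) (inv_pos.mpr ht)
        (inv_lt_one_of_one_lt₀ h1)
        (by rw [inv_pow, ← mul_inv]; exact inv_lt_one_of_one_lt₀ h2) ha hm hmN
      rw [inv_zpow, inv_zpow, ← mul_inv] at this
      linarith [(inv_lt_one₀ (by positivity)).mp this]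
    · linarith

theorem rank_eq_card {N : ℕ} (α : Comp N) (i : Fin N) :
    rank α i = (Finset.univ.filter fun j => α i < α j ∨ (α j = α i ∧ j ≤ i)).card := by
  rw [rank, Finset.filter_or, Finset.card_union_of_disjoint]
  · congr 2
    ext j
    simp [and_comm]
  · rw [Finset.disjoint_filter]
    intro j _ h
    omega

theorem rank_le {N : ℕ} (α : Comp N) (i : Fin N) : rank α i ≤ N := by
  rw [rank_eq_card]
  exact (Finset.card_le_univ _).trans_eq (Fintype.card_fin N)

theorem one_le_rank {N : ℕ} (α : Comp N) (i : Fin N) : 1 ≤ rank α i := by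
  rw [rank_eq_card]
  exact Finset.card_pos.mpr ⟨i, by simp⟩

theorem rank_lt_rank {N : ℕ} {α : Comp N} {i j : Fin N}
    (h : α i < α j ∨ (α j = α i ∧ j < i)) : rank α j < rank α i := by
  rw [rank_eq_card, rank_eq_card]
  apply Finset.card_lt_card
  rw [Finset.ssubset_iff_of_subset]
  · refine ⟨i, by simp, ?_⟩
    simp only [Finset.mem_filter, Finset.mem_univ, true_and, Fin.lt_def, Fin.le_def] at h ⊢
    omega
  · intro k
    simp only [Finset.mem_filter, Finset.mem_univ, true_and, Fin.lt_def, Fin.le_def] at h ⊢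
    omega

/-- For `q, t < 1` a smaller rank means smaller powers of both `q` and `t`, so the ranks can be read
off from the order of the spectral values. The whole vector is needed, since a power of `q` may
equal a power of `t`. -/
theorem rank_eq_card_spectral {N : ℕ} {q t : ℝ} (hq : 0 < q) (ht : 0 < t) (hq1 : q < 1)
    (ht1 : t < 1) (α : Comp N) (i : Fin N) :
    rank α i = (Finset.univ.filter fun j => spectral q t α j ≤ spectral q t α i).card := by
  have key : ∀ {i j : Fin N}, α i < α j ∨ (α j = α i ∧ j < i) →
      spectral q t α j < spectral q t α i := by
    intro i j h
    have hr := rank_lt_rank h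
    have h1 : q ^ α j ≤ q ^ α i := pow_le_pow_of_le_one hq.le hq1.le (by omega)
    have h2 : t ^ ((N : ℤ) - rank α j) < t ^ ((N : ℤ) - rank α i) :=
      zpow_lt_zpow_right_of_lt_one₀ ht ht1 (by omega)
    exact mul_lt_mul' h1 h2 (by positivity) (by positivity)
  rw [rank_eq_card]
  congr 1
  apply Finset.filter_congr
  intro j _
  constructor
  · intro h
    rcases eq_or_ne j i with rfl | hne
    · exact le_rfl
    · refine (key ?_).le
      rcases h with h | ⟨h, h'⟩
      · exact Or.inl h
      · exact Or.inr ⟨h, lt_of_le_of_ne h' hne⟩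
  · intro h
    by_contra hc
    refine absurd (key (i := j) (j := i) ?_) (not_lt.mpr h)
    simp only [Fin.lt_def, Fin.le_def] at hc ⊢
    omega

theorem spectral_injective_of_lt {N : ℕ} {q t : ℝ} (hq : 0 < q) (ht : 0 < t) (hq1 : q < 1)
    (hqt : q * t ^ N < 1) {α β : Comp N}
    (h : ∀ i, spectral q t α i = spectral q t β i) : α = β := by
  rcases lt_or_ge t 1 with ht1 | ht1
  · funext i
    have hr : rank α i = rank β i := by
      rw [rank_eq_card_spectral hq ht hq1 ht1, rank_eq_card_spectral hq ht hq1 ht1]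
      simp only [h]
    have e := h i
    rw [spectral, spectral, hr] at e
    have e' := mul_right_cancel₀ (by positivity) e
    exact pow_right_injective₀ hq hq1.ne e'
  -- For `t ≥ 1` one coordinate suffices: if `α i < β i`, equality would make a power of `t` that is
  -- at least `1` equal to some `q^a t^m < 1`.
  · have key : ∀ {α β : Comp N} {i : Fin N}, spectral q t α i = spectral q t β i →
        β i ≤ α i := by
      intro α β i e
      by_contra hc
      push Not at hc
      have h1 := rank_le α i
      have h2 := rank_le β i
      have e1 : t ^ ((N : ℤ) - rank α i) =
          q ^ ((β i : ℤ) - α i) * t ^ ((N : ℤ) - rank β i) := by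
        rw [spectral, spectral] at e
        rw [zpow_sub₀ hq.ne', zpow_natCast, zpow_natCast]
        field_simp
        linear_combination e
      have h3 := zpow_mul_zpow_lt_one hq ht hq1 hqt (a := (β i : ℤ) - α i)
        (m := (N : ℤ) - rank β i) (by omega) (by omega) (by omega)
      have h4 : 1 ≤ t ^ ((N : ℤ) - rank α i) := one_le_zpow₀ ht1 (by omega)
      linarith
    funext i
    exact (key (h i).symm).antisymm (key (h i))

theorem spectral_inv {N : ℕ} (q t : ℝ) (α : Comp N) (i : Fin N) :
    spectral q⁻¹ t⁻¹ α i = (spectral q t α i)⁻¹ := by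
  rw [spectral, spectral, inv_pow, inv_zpow, mul_inv]

theorem spectral_injective {N : ℕ} {q t : ℝ} (hq : 0 < q) (ht : 0 < t)
    (hqt : (q < 1 ∧ q * t ^ N < 1) ∨ (1 < q ∧ 1 < q * t ^ N)) {α β : Comp N}
    (h : ∀ i, spectral q t α i = spectral q t β i) : α = β := by
  rcases hqt with ⟨h1, h2⟩ | ⟨h1, h2⟩
  · exact spectral_injective_of_lt hq ht h1 h2 h
  · refine spectral_injective_of_lt (inv_pos.mpr hq) (inv_pos.mpr ht)
      (inv_lt_one_of_one_lt₀ h1)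
      (by rw [inv_pow, ← mul_inv]; exact inv_lt_one_of_one_lt₀ h2) fun i => ?_
    rw [spectral_inv, spectral_inv, h]

/-! ### Existence of the nonsymmetric Macdonald polynomials -/

/-- The lower set `s` is built up by height. For a new top element `a`, some `ξ_i` has different
eigenvalues at `α` and `a`. The factor `ξ_i - ζ_a(i)` sends `x^a` into the span of lower monomials,
which `P` already kills, and its diagonal entry at `α` is nonzero. -/
theorem exists_annihilator {N : ℕ} {q t : ℝ} (hq : 0 < q) (ht : 0 < t)
    (hqt : (q < 1 ∧ q * t ^ N < 1) ∨ (1 < q ∧ 1 < q * t ^ N)) (α : Comp N)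
    (s : Finset (Comp N)) (hα : α ∉ s) (hs : ∀ β ∈ s, ∀ γ, Above β γ → γ ∈ s) :
    ∃ (P : Module.End ℝ (Poly N)) (d : Comp N → ℝ), IsTri P d ∧ d α ≠ 0 ∧
      (∀ i, Commute P (cherednikEnd q ht.ne' i)) ∧ ∀ β ∈ s, P (mono β) = 0 := by
  classical
  induction s using Finset.induction_on_max_value height with
  | empty => exact ⟨1, _, isTri_one, one_ne_zero, fun i => Commute.one_left _, by simp⟩
  | insert a s ha hmax ih =>
    have hs' : ∀ β ∈ insert a s, ∀ γ, Above β γ → γ ∈ s := by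
      intro β hβ γ h
      refine (Finset.mem_insert.mp (hs β hβ γ h)).resolve_left ?_
      rintro rfl
      rcases Finset.mem_insert.mp hβ with rfl | hβ
      · exact not_above_self _ h
      · exact absurd h.height_lt (not_lt.mpr (hmax β hβ))
    obtain ⟨P, d, hP, hd, hc, hk⟩ := ih (fun h => hα (Finset.mem_insert_of_mem h))
      (fun β hβ => hs' β (Finset.mem_insert_of_mem hβ))
    obtain ⟨i, hi⟩ : ∃ i, spectral q t α i ≠ spectral q t a i := by
      by_contra hcon
      push Not at hcon
      exact hα (spectral_injective hq ht hqt hcon ▸ Finset.mem_insert_self _ _)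
    set Q := cherednikEnd q ht.ne' i + (-spectral q t a i) • (1 : Module.End ℝ (Poly N)) with hQ
    have hPQ : Commute P Q := (hc i).add_right ((Commute.one_right P).smul_right _)
    refine ⟨P * Q, _, hP.mul ((isTri_cherednikEnd q ht.ne' i).add (isTri_one.smul _)), ?_, ?_, ?_⟩
    · refine mul_ne_zero hd ?_
      rw [mul_one, ← sub_eq_add_neg]
      exact sub_ne_zero.mpr hi
    · intro j
      exact (hc j).mul_left ((commute_cherednikEnd hq.ne' ht.ne' i j).add_left
        ((Commute.one_left _).smul_left _))
    · intro β hβ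
      rcases Finset.mem_insert.mp hβ with rfl | hβ'
      · have h1 : Q (mono β) ∈ below β := by
          have := isTri_cherednikEnd q ht.ne' i β
          rw [hQ, LinearMap.add_apply, LinearMap.smul_apply, Module.End.one_apply, neg_smul,
            ← sub_eq_add_neg]
          exact this
        have h2 : below β ≤ LinearMap.ker P := by
          rw [below, Submodule.span_le]
          rintro _ ⟨γ, hγ, rfl⟩
          exact hk γ (hs' β hβ γ hγ)
        exact h2 h1
      · rw [hPQ.eq, Module.End.mul_apply, hk β hβ', map_zero]

theorem leadingCoeff_ne_zero {N : ℕ} {q t : ℝ} (hq : 0 < q) (ht : 0 < t) (α : Comp N) :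
    leadingCoeff q t α ≠ 0 := by
  rw [leadingCoeff]
  positivity

theorem exists_isMacdonald {N : ℕ} {q t : ℝ} (hq : 0 < q) (ht : 0 < t)
    (hqt : (q < 1 ∧ q * t ^ N < 1) ∨ (1 < q ∧ 1 < q * t ^ N)) (α : Comp N) :
    ∃ p, IsMacdonald q t α p := by
  obtain ⟨P, d, hP, hd, hc, hk⟩ := exists_annihilator hq ht hqt α (finite_above α).toFinset
    (by simpa using not_above_self α)
    (fun β hβ γ h => by
      simp only [Set.Finite.mem_toFinset, Set.mem_ofPred_eq] at hβ ⊢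
      exact hβ.trans h)
  have hker : below α ≤ LinearMap.ker P := by
    rw [below, Submodule.span_le]
    rintro _ ⟨γ, hγ, rfl⟩
    exact hk γ (by simpa using hγ)
  have hcoeff : ∀ β, coeff (Finsupp.equivFunOnFinite.symm β) (P (mono α)) =
      (if α = β then d α else 0) +
        coeff (Finsupp.equivFunOnFinite.symm β) (P (mono α) - d α • mono α) := by
    intro β
    rw [coeff_sub, coeff_smul, coeff_mono]
    split_ifs <;> simp
  set c := leadingCoeff q t α / d α
  refine ⟨c • P (mono α), ?_, ?_, ?_⟩
  · have h0 : coeff (Finsupp.equivFunOnFinite.symm α) (P (mono α) - d α • mono α) = 0 := by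
      by_contra h
      exact not_above_self α (above_of_mem_below (hP α) h)
    rw [coeff_smul, hcoeff, h0, if_pos rfl, add_zero, smul_eq_mul]
    exact div_mul_cancel₀ _ hd
  · intro β hβ
    rw [coeff_smul] at hβ
    have hβ' := right_ne_zero_of_smul hβ
    rcases eq_or_ne β α with h | h
    · exact Or.inl h
    · rw [hcoeff, if_neg h.symm, zero_add] at hβ'
      exact Or.inr (above_of_mem_below (hP α) hβ')
  · intro i
    -- `(ξ_i - ζ_α(i)) x^α` lies below `α`, hence is killed by `P`; as `P` commutes with `ξ_i`, the
    -- image `P x^α` is an eigenvector.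
    have h1 := LinearMap.mem_ker.mp (hker (isTri_cherednikEnd q ht.ne' i α))
    rw [map_sub, map_smul, sub_eq_zero, ← Module.End.mul_apply, (hc i).eq,
      Module.End.mul_apply] at h1
    rw [← cherednikEnd_apply q ht.ne', map_smul, h1, ← smul_eq_C_mul, smul_comm]

theorem isMacdonald_macdonald {N : ℕ} {q t : ℝ} (hq : 0 < q) (ht : 0 < t)
    (hqt : (q < 1 ∧ q * t ^ N < 1) ∨ (1 < q ∧ 1 < q * t ^ N)) (α : Comp N) :
    IsMacdonald q t α (macdonald q t α) := by
  have h := exists_isMacdonald hq ht hqt α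
  rw [macdonald, dif_pos h]
  exact h.choose_spec

/-! ### The basis of Macdonald polynomials -/

theorem linearIndependent_of_isMacdonald {N : ℕ} {q t : ℝ} (hq : 0 < q) (ht : 0 < t)
    {M : Comp N → Poly N} (hM : ∀ α, IsMacdonald q t α (M α)) : LinearIndependent ℝ M := by
  rw [linearIndependent_iff]
  intro l hl
  by_contra hne
  obtain ⟨α, hα, hmax⟩ := Finset.exists_max_image l.support height
    (Finsupp.support_nonempty_iff.mpr hne)
  have h := congrArg (coeff (Finsupp.equivFunOnFinite.symm α)) hl
  rw [Finsupp.linearCombination_apply, Finsupp.sum, coeff_sum, coeff_zero,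
    Finset.sum_eq_single_of_mem α hα, coeff_smul, (hM α).coeff_self] at h
  · exact smul_ne_zero (Finsupp.mem_support_iff.mp hα) (leadingCoeff_ne_zero hq ht α) h
  · intro β hβ hβα
    rw [coeff_smul]
    by_contra hc
    rcases (hM β).triangular α (right_ne_zero_of_smul hc) with h | h
    · exact hβα h.symm
    · exact absurd h.height_lt (not_lt.mpr (hmax β hβ))

theorem span_of_isMacdonald {N : ℕ} {q t : ℝ} (hq : 0 < q) (ht : 0 < t)
    {M : Comp N → Poly N} (hM : ∀ α, IsMacdonald q t α (M α)) :
    ⊤ ≤ Submodule.span ℝ (Set.range M) := by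
  rw [← span_mono, Submodule.span_le]
  rintro _ ⟨α, rfl⟩
  induction α using above_induction with
  | h α ih =>
    have e : M α = ∑ s ∈ (M α).support, coeff s (M α) • mono (Finsupp.equivFunOnFinite s) := by
      conv_lhs => rw [(M α).as_sum]
      apply Finset.sum_congr rfl
      intro s _
      rw [mono, smul_monomial, smul_eq_mul, mul_one, Equiv.symm_apply_apply]
    have hlc := leadingCoeff_ne_zero hq ht α
    have hmem : Finsupp.equivFunOnFinite.symm α ∈ (M α).support := by
      rw [mem_support_iff, (hM α).coeff_self]
      exact hlc
    rw [← Finset.add_sum_erase _ _ hmem, (hM α).coeff_self, Equiv.apply_symm_apply] at e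
    have h1 : leadingCoeff q t α • mono α ∈ Submodule.span ℝ (Set.range M) := by
      rw [eq_sub_of_add_eq e.symm]
      refine sub_mem (Submodule.subset_span ⟨α, rfl⟩) (Submodule.sum_mem _ fun s hs => ?_)
      rw [Finset.mem_erase, mem_support_iff] at hs
      refine Submodule.smul_mem _ _ (ih _ ?_)
      refine ((hM α).triangular (Finsupp.equivFunOnFinite s) ?_).resolve_left ?_
      · rw [Equiv.symm_apply_apply]
        exact hs.2
      · rintro rfl
        exact hs.1 (Equiv.symm_apply_apply _ _).symm
    exact (Submodule.smul_mem_iff _ hlc).mp h1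

/-! ### Positivity of the norms -/

/-- For `z = q^a t^m` the numerator of `u` is `t (1 - q^a t^(m-1)) (1 - q^a t^(m+1))`. The bounds on
`m` keep both exponents of `t` in `[0, N]`; differences of two ranks satisfy them. -/
theorem u_pos {N : ℕ} {q t : ℝ} (hq : 0 < q) (ht : 0 < t)
    (hqt : (q < 1 ∧ q * t ^ N < 1) ∨ (1 < q ∧ 1 < q * t ^ N)) {a m : ℤ} (ha : 1 ≤ a)
    (hm : 1 ≤ m) (hmN : m + 1 ≤ N) : 0 < u t (q ^ a * t ^ m) := by
  have h1 := one_sub_mul_one_sub_pos hq ht hqt ha (m := m - 1) (by omega) (by omega)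
  have h2 := one_sub_mul_one_sub_pos hq ht hqt ha (m := m) (by omega) (by omega)
  have h3 := one_sub_mul_one_sub_pos hq ht hqt ha (m := m + 1) (by omega) (by omega)
  have e : (1 - q) ^ 2 * ((t - q ^ a * t ^ m) * (1 - q ^ a * t ^ m * t)) =
      t * (((1 - q ^ a * t ^ (m - 1)) * (1 - q)) * ((1 - q ^ a * t ^ (m + 1)) * (1 - q))) := by
    rw [zpow_sub_one₀ ht.ne', zpow_add_one₀ ht.ne']
    field_simp
  have h4 : 0 < (1 - q) ^ 2 * ((t - q ^ a * t ^ m) * (1 - q ^ a * t ^ m * t)) := by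
    rw [e]
    positivity
  exact div_pos (pos_of_mul_pos_right h4 (sq_nonneg _))
    (sq_pos_of_ne_zero (left_ne_zero_of_mul h2.ne'))

theorem scriptE_pos {N : ℕ} {q t : ℝ} (hq : 0 < q) (ht : 0 < t)
    (hqt : (q < 1 ∧ q * t ^ N < 1) ∨ (1 < q ∧ 1 < q * t ^ N)) (α : Comp N) :
    0 < scriptE q t α := by
  apply Finset.prod_pos
  intro p hp
  rw [Finset.mem_filter] at hp
  have h1 := rank_lt_rank (Or.inl hp.2.2)
  have h2 := rank_le α p.1
  have h3 := one_le_rank α p.2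
  exact u_pos hq ht hqt (by omega) (by omega) (by omega)

theorem lt_conj {N : ℕ} {l : Comp N} (hl : Antitone l) {i : Fin N} {j : ℕ} (hj : j ≤ l i) :
    (i : ℕ) < conj l j := by
  have h : Finset.Iic i ⊆ Finset.univ.filter fun k => j ≤ l k := by
    intro k hk
    rw [Finset.mem_filter]
    exact ⟨Finset.mem_univ _, hj.trans (hl (Finset.mem_Iic.mp hk))⟩
  have := Finset.card_le_card h
  rw [Fin.card_Iic] at this
  exact this

theorem conj_le {N : ℕ} (l : Comp N) (j : ℕ) : conj l j ≤ N :=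
  (Finset.card_le_univ _).trans_eq (Fintype.card_fin N)

/-- Each box gives `1 - q^(1+arm) t^(leg+m)` with `0 ≤ leg ≤ N - 1`, and is paired with one factor
`1 - q`. The cases `m = 0, 1` are the two hook products of the norm. -/
theorem hookProd_mul_pos {N : ℕ} {q t : ℝ} (hq : 0 < q) (ht : 0 < t)
    (hqt : (q < 1 ∧ q * t ^ N < 1) ∨ (1 < q ∧ 1 < q * t ^ N)) {l : Comp N} (hl : Antitone l)
    {m : ℕ} (hm : m ≤ 1) : 0 < hookProd q t l (q * t ^ m) * (1 - q) ^ ∑ i, l i := by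
  rw [← Finset.prod_pow_eq_pow_sum, hookProd, ← Finset.prod_mul_distrib]
  apply Finset.prod_pos
  intro i _
  rw [show (1 - q) ^ l i = ∏ j ∈ Finset.Icc 1 (l i), (1 - q) by simp,
    ← Finset.prod_mul_distrib]
  apply Finset.prod_pos
  intro j hj
  rw [Finset.mem_Icc] at hj
  have h1 := lt_conj hl hj.2
  have h2 := conj_le l j
  have h3 := i.isLt
  have := one_sub_mul_one_sub_pos hq ht hqt (a := 1 + ((l i : ℤ) - j))
    (m := m + ((conj l j : ℤ) - ((i : ℕ) + 1))) (by omega) (by omega) (by omega)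
  rw [zpow_add₀ hq.ne', zpow_add₀ ht.ne', zpow_one, zpow_natCast t m] at this
  exact this.trans_eq (by ring)

theorem qtPoch_mul_pos {N : ℕ} {q t : ℝ} (hq : 0 < q) (ht : 0 < t)
    (hqt : (q < 1 ∧ q * t ^ N < 1) ∨ (1 < q ∧ 1 < q * t ^ N)) (l : Comp N) :
    0 < qtPoch q t (q * t ^ N) l * (1 - q) ^ ∑ i, l i := by
  rw [← Finset.prod_pow_eq_pow_sum, qtPoch, ← Finset.prod_mul_distrib]
  apply Finset.prod_pos
  intro i _
  rw [show (1 - q) ^ l i = ∏ j ∈ Finset.range (l i), (1 - q) by simp, qPoch,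
    ← Finset.prod_mul_distrib]
  apply Finset.prod_pos
  intro j _
  have h3 := i.isLt
  have := one_sub_mul_one_sub_pos hq ht hqt (a := 1 + (j : ℤ))
    (m := N + -((i : ℕ) : ℤ)) (by omega) (by omega) (by omega)
  rw [zpow_add₀ hq.ne', zpow_add₀ ht.ne', zpow_one, zpow_natCast t N, zpow_natCast q j] at this
  exact this.trans_eq (by ring)

theorem div_pos_of_mul_pos {x y e : ℝ} (hx : 0 < x * e) (hy : 0 < y * e) : 0 < x / y := by
  rw [← mul_div_mul_right x y (right_ne_zero_of_mul hx.ne')]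
  exact div_pos hx hy

theorem partitionNorm_pos {N : ℕ} {q t : ℝ} (hq : 0 < q) (ht : 0 < t)
    (hqt : (q < 1 ∧ q * t ^ N < 1) ∨ (1 < q ∧ 1 < q * t ^ N)) {l : Comp N} (hl : Antitone l) :
    0 < partitionNorm q t l := by
  have h0 := hookProd_mul_pos hq ht hqt hl zero_le_one
  have h1 := hookProd_mul_pos hq ht hqt hl le_rfl
  have h2 := qtPoch_mul_pos hq ht hqt l
  rw [pow_zero, mul_one] at h0
  rw [pow_one] at h1
  have h3 : 0 < (1 - q) ^ (∑ i, l i) * (1 - q) ^ (∑ i, l i) :=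
    mul_self_pos.mpr (right_ne_zero_of_mul h2.ne')
  exact mul_pos (mul_pos (zpow_pos ht _) (div_pos_of_mul_pos h0 h1)) (div_pos_of_mul_pos h2 h3)

theorem compNorm_pos {N : ℕ} {q t : ℝ} (hq : 0 < q) (ht : 0 < t)
    (hqt : (q < 1 ∧ q * t ^ N < 1) ∨ (1 < q ∧ 1 < q * t ^ N)) (α : Comp N) :
    0 < compNorm q t α :=
  mul_pos (inv_pos.mpr (scriptE_pos hq ht hqt α)) (partitionNorm_pos hq ht hqt (plus_antitone α))

/-! ### The form -/

theorem scalarForm_pos {N : ℕ} {q t : ℝ} (hq : 0 < q) (ht : 0 < t)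
    (hqt : (q < 1 ∧ q * t ^ N < 1) ∨ (1 < q ∧ 1 < q * t ^ N)) {f : Poly N} (hf : f ≠ 0) :
    0 < scalarForm N q t f f := by
  have hM : ∀ α : Comp N, IsMacdonald q t α (macdonald q t α) :=
    isMacdonald_macdonald hq ht hqt
  have h : LinearIndependent ℝ (macdonald (N := N) q t) ∧
      ⊤ ≤ Submodule.span ℝ (Set.range (macdonald (N := N) q t)) :=
    ⟨linearIndependent_of_isMacdonald hq ht hM, span_of_isMacdonald hq ht hM⟩
  -- The form would be zero without a basis, so this is where existence and triangularity enter.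
  rw [scalarForm, dif_pos h]
  set b := Module.Basis.mk h.1 h.2
  -- With `c_α` the coordinates of `f`, the value becomes the sum of `c_α² ⟨M_α, M_α⟩` over the
  -- support of `f`.
  rw [Module.Basis.constr_apply, Finsupp.sum, LinearMap.sum_apply]
  apply Finset.sum_pos
  · intro α hα
    rw [LinearMap.smul_apply, LinearMap.smul_apply, Module.Basis.coord_apply, smul_eq_mul,
      smul_eq_mul, mul_left_comm]
    exact mul_pos (compNorm_pos hq ht hqt α) (mul_self_pos.mpr (Finsupp.mem_support_iff.mp hα))
  · rw [Finsupp.support_nonempty_iff]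
    exact fun e => hf (by simpa using e)

end

end ScalarMacdonald

theorem mainTheorem6 (N : ℕ) (q t : ℝ) (hq : 0 < q) (ht : 0 < t)
    (hqt : q < min 1 (t ^ (-(N : ℤ))) ∨ max 1 (t ^ (-(N : ℤ))) < q) :
    (∀ α : Fin N → ℕ,
      0 < ScalarMacdonald.scalarForm N q t
        (ScalarMacdonald.macdonald q t α) (ScalarMacdonald.macdonald q t α)) ∧
    (∀ f : MvPolynomial (Fin N) ℝ, f ≠ 0 → 0 < ScalarMacdonald.scalarForm N q t f f) := by
  have hqt' : (q < 1 ∧ q * t ^ N < 1) ∨ (1 < q ∧ 1 < q * t ^ N) := by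
    rw [zpow_neg, zpow_natCast, lt_min_iff, max_lt_iff] at hqt
    exact hqt.imp (And.imp_right fun h => (lt_mul_inv_iff₀ (by positivity)).mp (by rwa [one_mul]))
      (And.imp_right (inv_lt_iff_one_lt_mul₀ (by positivity)).mp)
  refine ⟨fun α => ScalarMacdonald.scalarForm_pos hq ht hqt' ?_,
    fun f hf => ScalarMacdonald.scalarForm_pos hq ht hqt' hf⟩
  -- Positivity at `M_α` is the case `f = M_α` of the general statement, as members of an
  -- independent family are nonzero.
  exact (ScalarMacdonald.linearIndependent_of_isMacdonald hq ht
    (ScalarMacdonald.isMacdonald_macdonald hq ht hqt')).ne_zero α
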